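/- **Theorem 1.2 ($\mathbf q$-right-quantum Sylvester's determinant identity).** Let $0\le n<m$ be integers and fix non-zero complex numbers $q_{ij}$ for $1\le i<j\le m$. Let $\mathcal A$ be the $\mathbb C$-algebra of formal power series in non-commuting variables $a_{ij}$, $1\le i,j\le m$, and let $\mathcal I\subseteq\mathcal A$ be a two-sided ideal modulo which $A=(a_{ij})_{m\times m}$ is $\mathbf q$-right-quantum, i.e. such that in $\mathcal A/\mathcal I$ $$a_{jk}a_{ik}=q_{ij}\,a_{ik}a_{jk}\quad\text{for all } i<j \text{ and all } k,$$ $$a_{ik}a_{jl}-q_{ij}^{-1}a_{jk}a_{il}=q_{kl}q_{ij}^{-1}a_{jl}a_{ik}-q_{kl}\,a_{il}a_{jk}\quad\text{for all } i<j,\ k<l$$ (for instance, the two-sided ideal generated by these relations). For a $k\times k$ matrix $B=(b_{pr})$ whose entries are finite linear combinations of words in the $a_{ij}$, $\det_{\mathbf q}B$ is obtained by expanding $\sum_{\sigma\in S_k}(-1)^{\operatorname{inv}\sigma}\,b_{\sigma(1)1}\cdots b_{\sigma(k)k}$ into words and multiplying each word $a_{\lambda_1\mu_1}\cdots a_{\lambda_\ell\mu_\ell}$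 by the weight $$\prod_{p<r,\ \mu_p>\mu_r}q_{\mu_r\mu_p}\ \prod_{p<r,\ \lambda_p>\lambda_r}q_{\lambda_r\lambda_p}^{-1}.$$ In particular, $$\textstyle\det_{\mathbf q}(I-A)=\sum_{J\subseteq\{1,\dots,m\}}(-1)^{|J|}\det_{\mathbf q}A_J,\qquad \det_{\mathbf q}A_J=\sum_{\sigma\in S_J}(-1)^{\operatorname{inv}\sigma}\Big(\prod_{p<r,\ \sigma(j_p)>\sigma(j_r)}q_{\sigma(j_r)\sigma(j_p)}^{-1}\Big)a_{\sigma(j_1)j_1}\cdots a_{\sigma(j_k)j_k}$$ for $J=\{j_1<\dots<j_k\}$. Let $A_0=(a_{ij})_{1\le i,j\le n}$ and, for $n<i,j\le m$, let $a_{i*}=(a_{i1},\dots,a_{in})$ and $a_{*j}=(a_{1j},\dots,a_{nj})^T$. Then $\det_{\mathbf q}(I-A_0)$ is invertible in $\mathcal A/\mathcal I$. Put $$c_{ij}=-\textstyle\det_{\mathbf q}^{-1}(I-A_0)\cdot\det_{\mathbf q}\begin{pmatrix}I-A_0&-a_{*j}\\-a_{i*}&-a_{ij}\end{pmatrix}\in\mathcal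 A/\mathcal I,\qquad C=(c_{ij})_{n+1\le i,j\le m}.$$ Suppose that $q_{ij}=q_{i'j'}$ for all $i,i'\le n$ and $j,j'>n$. Then, in $\mathcal A/\mathcal I$, $$\textstyle\det_{\mathbf q}^{-1}(I-A_0)\cdot\det_{\mathbf q}(I-A)=\det_{\mathbf q}(I-C),$$ where $\det_{\mathbf q}(I-C)$ is expanded in words in the $c_{ij}$ (the words being weighted by the same rule, with the parameters $q_{ij}$, $n<i<j\le m$), that is, $\det_{\mathbf q}(I-C)=\sum_{J\subseteq\{n+1,\dots,m\}}(-1)^{|J|}\det_{\mathbf q}C_J$. -/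

import Mathlib

/-- Formal power series over `R` in non-commuting variables indexed by `X`: arbitrary families of
coefficients, one for each word in the alphabet `X`. -/
def NCPowerSeries (X R : Type*) : Type _ := List X → R

namespace NCPowerSeries

variable {X R : Type*}

@[ext]
theorem ext {f g : NCPowerSeries X R} (h : ∀ w : List X, f w = g w) : f = g := funext h

instance [AddCommGroup R] : AddCommGroup (NCPowerSeries X R) :=
  inferInstanceAs (AddCommGroup (List X → R))

instance {S : Type*} [Semiring S] [AddCommGroup R] [Module S R] :
    Module S (NCPowerSeries X R) :=
  inferInstanceAs (Module S (List X → R))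

/-- Concatenation product: the coefficient of a word `w` in `f * g` is the sum of
`f u * g v` over all factorizations `w = u ++ v`. -/
instance [Ring R] : Mul (NCPowerSeries X R) :=
  ⟨fun f g w => ∑ k ∈ Finset.range (w.length + 1), f (w.take k) * g (w.drop k)⟩

open Classical in
/-- The series consisting of the single word `w` with coefficient `1`. -/
noncomputable def word [Ring R] (w : List X) : NCPowerSeries X R := fun v => if v = w then 1 else 0

noncomputable instance [Ring R] : One (NCPowerSeries X R) := ⟨word []⟩

/-- The variable indexed by `x`. -/
noncomputable def var [Ring R] (x : X) : NCPowerSeries X R := word [x]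

section lemmas

variable [Ring R]

theorem add_apply (f g : NCPowerSeries X R) (w : List X) : (f + g) w = f w + g w := rfl

theorem zero_apply (w : List X) : (0 : NCPowerSeries X R) w = 0 := rfl

theorem mul_apply (f g : NCPowerSeries X R) (w : List X) :
    (f * g) w = ∑ k ∈ Finset.range (w.length + 1), f (w.take k) * g (w.drop k) := rfl

theorem one_apply (w : List X) :
    (1 : NCPowerSeries X R) w = if w.length = 0 then 1 else 0 := by
  change word [] w = _
  simp [word]

theorem smul_apply {S : Type*} [Semiring S] [Module S R] (c : S) (f : NCPowerSeries X R)
    (w : List X) : (c • f) w = c • f w := rfl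

protected theorem one_mul' (f : NCPowerSeries X R) : 1 * f = f := by
  ext w
  rw [NCPowerSeries.mul_apply, Finset.sum_eq_single 0]
  · simp [NCPowerSeries.one_apply]
  · intro k hk hne
    rw [Finset.mem_range] at hk
    have hl : (w.take k).length ≠ 0 := by rw [List.length_take]; omega
    rw [NCPowerSeries.one_apply, if_neg hl, zero_mul]
  · intro h
    simp at h

protected theorem mul_one' (f : NCPowerSeries X R) : f * 1 = f := by
  ext w
  rw [NCPowerSeries.mul_apply, Finset.sum_eq_single w.length]
  · simp [NCPowerSeries.one_apply]
  · intro k hk hne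
    rw [Finset.mem_range] at hk
    have hl : (w.drop k).length ≠ 0 := by rw [List.length_drop]; omega
    rw [NCPowerSeries.one_apply, if_neg hl, mul_zero]
  · intro h
    simp at h

protected theorem mul_assoc' (f g h : NCPowerSeries X R) : f * g * h = f * (g * h) := by
  ext w
  have e1 : (f * g * h) w = ∑ k ∈ Finset.range (w.length + 1), ∑ l ∈ Finset.range (k + 1),
      f (w.take l) * (g ((w.drop l).take (k - l)) * h (w.drop k)) := by
    rw [NCPowerSeries.mul_apply]
    refine Finset.sum_congr rfl fun k hk => ?_
    rw [Finset.mem_range] at hk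
    have hl : (w.take k).length = k := by rw [List.length_take]; omega
    rw [NCPowerSeries.mul_apply, hl, Finset.sum_mul]
    refine Finset.sum_congr rfl fun l hl => ?_
    rw [Finset.mem_range] at hl
    rw [List.take_take, List.drop_take, min_eq_left (by omega), mul_assoc]
  have e2 : (f * (g * h)) w = ∑ l ∈ Finset.range (w.length + 1),
      ∑ t ∈ Finset.range (w.length - l + 1),
        f (w.take l) * (g ((w.drop l).take t) * h (w.drop (l + t))) := by
    rw [NCPowerSeries.mul_apply]
    refine Finset.sum_congr rfl fun l hl => ?_
    rw [NCPowerSeries.mul_apply, List.length_drop, Finset.mul_sum]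
    refine Finset.sum_congr rfl fun t ht => ?_
    rw [List.drop_drop]
  rw [e1, e2, Finset.sum_sigma', Finset.sum_sigma']
  refine Finset.sum_nbij' (fun p => ⟨p.2, p.1 - p.2⟩) (fun p => ⟨p.1 + p.2, p.1⟩) ?_ ?_ ?_ ?_ ?_
  · rintro ⟨k, l⟩ h
    simp only [Finset.mem_sigma, Finset.mem_range] at h ⊢
    omega
  · rintro ⟨l, t⟩ h
    simp only [Finset.mem_sigma, Finset.mem_range] at h ⊢
    omega
  · rintro ⟨k, l⟩ h
    simp only [Finset.mem_sigma, Finset.mem_range] at h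
    simp only [Sigma.mk.injEq, heq_eq_eq, and_true]
    omega
  · rintro ⟨l, t⟩ h
    simp
  · rintro ⟨k, l⟩ h
    simp only [Finset.mem_sigma, Finset.mem_range] at h
    have : l + (k - l) = k := by omega
    simp only [this]

end lemmas

noncomputable instance [Ring R] : Ring (NCPowerSeries X R) where
  left_distrib f g h := by
    ext w
    simp only [NCPowerSeries.mul_apply, NCPowerSeries.add_apply, mul_add, Finset.sum_add_distrib]
  right_distrib f g h := by
    ext w
    simp only [NCPowerSeries.mul_apply, NCPowerSeries.add_apply, add_mul, Finset.sum_add_distrib]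
  zero_mul f := by
    ext w
    simp [NCPowerSeries.mul_apply, NCPowerSeries.zero_apply]
  mul_zero f := by
    ext w
    simp [NCPowerSeries.mul_apply, NCPowerSeries.zero_apply]
  mul_assoc := NCPowerSeries.mul_assoc'
  one_mul := NCPowerSeries.one_mul'
  mul_one := NCPowerSeries.mul_one'
  neg_add_cancel := neg_add_cancel
  zsmul := (· • ·)
  nsmul := (· • ·)
  nsmul_zero := AddMonoid.nsmul_zero
  nsmul_succ := AddMonoid.nsmul_succ
  zsmul_zero' := SubNegMonoid.zsmul_zero'
  zsmul_succ' := SubNegMonoid.zsmul_succ'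
  zsmul_neg' := SubNegMonoid.zsmul_neg'
  sub_eq_add_neg := sub_eq_add_neg

noncomputable instance {S : Type*} [CommSemiring S] [Ring R] [Algebra S R] :
    Algebra S (NCPowerSeries X R) :=
  Algebra.ofModule
    (fun c f g => by
      ext w
      simp only [NCPowerSeries.mul_apply, NCPowerSeries.smul_apply, smul_mul_assoc,
        Finset.smul_sum])
    (fun c f g => by
      ext w
      simp only [NCPowerSeries.mul_apply, NCPowerSeries.smul_apply, mul_smul_comm,
        Finset.smul_sum])

end NCPowerSeries

namespace QSylvester

/-- The matrix `A = (a_{ij})` satisfies the `q`-right-quantum relations. Only the parameters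
`q i j` with `i < j` are used. -/
def IsRightQuantum {ι S : Type*} [LinearOrder ι] [Ring S] [Algebra ℂ S] (q : ι → ι → ℂ)
    (A : Matrix ι ι S) : Prop :=
  (∀ i j k, i < j → A j k * A i k = q i j • (A i k * A j k)) ∧
  (∀ i j k l, i < j → k < l →
    A i k * A j l - (q i j)⁻¹ • (A j k * A i l) =
      (q k l * (q i j)⁻¹) • (A j l * A i k) - q k l • (A i l * A j k))

/-- Finite linear combinations of words in non-commuting variables `a_{ij}`, with `i, j` in `ι`. -/
abbrev WordPoly (ι : Type*) : Type _ := MonoidAlgebra ℂ (FreeMonoid (ι × ι))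

/-- The matrix `(a_{ij})` of variables. -/
noncomputable def varMatrix (ι : Type*) : Matrix ι ι (WordPoly ι) :=
  Matrix.of fun i j => MonoidAlgebra.of ℂ (FreeMonoid (ι × ι)) (FreeMonoid.of (i, j))

/-- Substitution of the entries of the matrix `A` for the variables `a_{ij}`. -/
noncomputable def evalAt {ι S : Type*} [Ring S] [Algebra ℂ S] (A : Matrix ι ι S) :
    WordPoly ι →ₐ[ℂ] S :=
  MonoidAlgebra.lift ℂ S (FreeMonoid (ι × ι)) (FreeMonoid.lift fun x => A x.1 x.2)

/-- The product of `q_{ν_r ν_p}` over all inversions of the word `ν`, that is, pairs of positions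
`p < r` with `ν_p > ν_r`: in `a :: ν`, the first letter `a` contributes `q b a` for each letter
`b < a` of `ν`. -/
def invWeight {ι : Type*} [LinearOrder ι] (q : ι → ι → ℂ) : List ι → ℂ
  | [] => 1
  | a :: ν => (ν.map fun b => if b < a then q b a else 1).prod * invWeight q ν

/-- The weight of the word `a_{λ,μ} = a_{λ₁μ₁} ⋯ a_{λₗμₗ}`: the product of `q_{μ_r μ_p}` over the
inversions of `μ` times the product of `q_{λ_r λ_p}⁻¹` over the inversions of `λ`. -/
noncomputable def wordWeight {ι : Type*} [LinearOrder ι] (q : ι → ι → ℂ)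
    (w : FreeMonoid (ι × ι)) : ℂ :=
  invWeight q (w.toList.map Prod.snd) * (invWeight q (w.toList.map Prod.fst))⁻¹

/-- Multiply the coefficient of each word by the weight of the word. -/
noncomputable def applyWeight {ι : Type*} [LinearOrder ι] (q : ι → ι → ℂ) (f : WordPoly ι) :
    WordPoly ι :=
  f.coeff.sum fun w c => MonoidAlgebra.single w (wordWeight q w * c)

/-- The `q`-determinant of a `k × k` matrix `B` of linear combinations of words: expand
`∑ σ, (-1)^{inv σ} b_{σ(1) 1} ⋯ b_{σ(k) k}` and weight each resulting word. -/
noncomputable def qDet {ι : Type*} [LinearOrder ι] (q : ι → ι → ℂ) {k : ℕ}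
    (B : Matrix (Fin k) (Fin k) (WordPoly ι)) : WordPoly ι :=
  applyWeight q (∑ σ : Equiv.Perm (Fin k),
    (Equiv.Perm.sign σ : ℤ) • (List.ofFn fun p : Fin k => B (σ p) p).prod)

section

variable {S : Type*} [Ring S] [Algebra ℂ S]

/-- `det_q (I - A)`, for a `k × k` matrix `A` over a `ℂ`-algebra: the expansion is in words in the
entries of `A`. -/
noncomputable def detOneSub {k : ℕ} (q : Fin k → Fin k → ℂ) (A : Matrix (Fin k) (Fin k) S) : S :=
  evalAt A (qDet q (1 - varMatrix (Fin k)))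

variable (n r : ℕ)

/-- The upper left `n × n` block `A₀` of an `(n + r) × (n + r)` matrix. -/
def corner {T : Type*} (A : Matrix (Fin (n + r)) (Fin (n + r)) T) : Matrix (Fin n) (Fin n) T :=
  A.submatrix (Fin.castAdd r) (Fin.castAdd r)

/-- The `(n + 1) × (n + 1)` matrix of blocks `I - A₀`, `-a_{*j}`, `-a_{i*}`, `-a_{ij}`, where `A` is
an `(n + r) × (n + r)` matrix and the indices `i`, `j` are taken among the last `r` ones. -/
def bordered {T : Type*} [Ring T] (A : Matrix (Fin (n + r)) (Fin (n + r)) T) (i j : Fin r) :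
    Matrix (Fin (n + 1)) (Fin (n + 1)) T :=
  Matrix.reindex finSumFinEquiv finSumFinEquiv
    (Matrix.fromBlocks (1 - corner n r A)
      (-Matrix.of fun k (_ : Fin 1) => A (Fin.castAdd r k) (Fin.natAdd n j))
      (-Matrix.of fun (_ : Fin 1) k => A (Fin.natAdd n i) (Fin.castAdd r k))
      (-Matrix.of fun (_ _ : Fin 1) => A (Fin.natAdd n i) (Fin.natAdd n j)))

variable (q : Fin (n + r) → Fin (n + r) → ℂ) (A : Matrix (Fin (n + r)) (Fin (n + r)) S)

/-- `det_q (I - A₀)`. -/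
noncomputable def detCorner : S :=
  evalAt A (qDet q (1 - corner n r (varMatrix (Fin (n + r)))))

/-- The `q`-determinant of the bordered matrix with index `(i, j)`. -/
noncomputable def detBordered (i j : Fin r) : S :=
  evalAt A (qDet q (bordered n r (varMatrix (Fin (n + r))) i j))

/-- The matrix `C` with entries
`c_{ij} = - det_q (I - A₀)⁻¹ * det_q (bordered matrix with index (i, j))`, indexed by the last `r`
indices. -/
noncomputable def sylvesterMatrix : Matrix (Fin r) (Fin r) S :=
  Matrix.of fun i j => -(Ring.inverse (detCorner n r q A) * detBordered n r q A i j)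

end

/-- The matrix of the variables `a_{ij}` of the algebra of formal power series, modulo the two-sided
ideal `I`. -/
noncomputable def quotientMatrix {ι : Type*} (I : TwoSidedIdeal (NCPowerSeries (ι × ι) ℂ)) :
    Matrix ι ι I.ringCon.Quotient :=
  Matrix.of fun i j => I.ringCon.mk' (NCPowerSeries.var (i, j))

end QSylvester

/-!
The identity is first proved for `q = 1`, where it is a statement about Manin matrices, and then
transported to general `q` by a twist.

*Manin matrices.* Let `ψ i` be the generators of an exterior algebra with coefficients in a
noncommutative algebra. The columns of a Manin matrix `M` give elements `∑ i, M i l ⊗ ψ i` that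
anticommute and square to zero (`oddVec_mul_oddVec`), and the top coefficient of their product is
the column determinant (`topCoeff_prod_oddVec`). Let `Ω` be the product over the first `n` columns.
Multiplication by `Ω` kills these columns, so the later ones may be cleared by column operations,
for which a right inverse of the corner suffices. This gives `det M = det (corner) * det (Schur
complement)` (`IsManin.colDet_eq_mul_schur`). Applied to `1 - A`, it is the identity for the entries
of the Schur complement, and applied to the bordered matrices, it expresses these entries through
determinants.

*The twist.* Let `x i` be the generators of a Heisenberg group over the scalars `ℂˣ` with
`x j * x i = (q i j)⁻¹ * x i * x j` for `i < j`. On the homogeneous functions on that group with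
values in the algebra, the operators `f ↦ (g ↦ A i k * f ((x k)⁻¹ * g * x i))` form a Manin matrix
if `A` is `q`-right-quantum (`isManin_twist`), and a word `a_{λ,μ}` in them has the effect
`f ↦ (g ↦ a_{λ,μ} * f ((x_μ)⁻¹ * g * x_λ))`. If `λ` is a rearrangement of `μ`, and `g` commutes with
the letters, then `(x_μ)⁻¹ * g * x_λ` is `g` times the weight of the word
(`apply_conj_eq_wordWeight_smul`): column determinants of the operators become `q`-determinants. The
right inverse of `1` minus the corner is a sum over paths, which exists because the matrix comes
from power series (`one_sub_twist_mul_pathMatrix`).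

The determinants of the corner and of the bordered matrices act in this way only at points `g`
that commute with the first `n` generators. Since the parameters between the two blocks of indices
are all equal, the points reached from the identity by entries of the Schur complement are of this
kind (`conj_mem_cornerCentralizer`), so there the Schur complement acts as the twist of `1 - C`.
Evaluation at the identity of the group gives the theorem.
-/

open scoped TensorProduct

namespace QSylvester

/-! ### Column determinants -/

section ColDet

variable {S T : Type*} [Ring S] [Ring T]

/-- The column determinant of a square matrix over a noncommutative ring: in each product the
factors are ordered by their columns. -/
noncomputable def colDet {k : ℕ} (M : Matrix (Fin k) (Fin k) S) : S :=
  ∑ σ : Equiv.Perm (Fin k), (Equiv.Perm.sign σ : ℤ) • (List.ofFn fun p => M (σ p) p).prod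

theorem ofFn_append_parts {α : Type*} {n r : ℕ} (f : Fin (n + r) → α) :
    List.ofFn f =
      (List.ofFn fun i => f (Fin.castAdd r i)) ++ List.ofFn fun i => f (Fin.natAdd n i) :=
  List.ofFn_add

theorem map_colDet {k : ℕ} (f : S →+* T) (M : Matrix (Fin k) (Fin k) S) :
    f (colDet M) = colDet (M.map f) := by
  simp only [colDet, map_sum, map_zsmul, map_list_prod, List.map_ofFn, Matrix.map_apply,
    Function.comp_def]

theorem colDet_one {k : ℕ} : colDet (1 : Matrix (Fin k) (Fin k) S) = 1 := by
  rw [colDet, Finset.sum_eq_single 1]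
  · simp [Matrix.one_apply]
  · intro σ _ hσ
    obtain ⟨p, hp⟩ : ∃ p, σ p ≠ p := by
      by_contra! h
      exact hσ (Equiv.ext h)
    rw [List.prod_eq_zero, smul_zero]
    exact List.mem_ofFn.2 ⟨p, Matrix.one_apply_ne hp⟩
  · simp

theorem colDet_fin_one (M : Matrix (Fin 1) (Fin 1) S) : colDet M = M 0 0 := by
  simp [colDet]

/-- The permutation of `Fin (n + r)` that acts as `σ` on the first `n` and as `τ` on the last `r`
elements. -/
def blockPerm {n r : ℕ} (σ : Equiv.Perm (Fin n)) (τ : Equiv.Perm (Fin r)) :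
    Equiv.Perm (Fin (n + r)) :=
  finSumFinEquiv.permCongr (σ.sumCongr τ)

theorem blockPerm_castAdd {n r : ℕ} (σ : Equiv.Perm (Fin n)) (τ : Equiv.Perm (Fin r)) (i : Fin n) :
    blockPerm σ τ (Fin.castAdd r i) = Fin.castAdd r (σ i) := by
  simp [blockPerm]

theorem blockPerm_natAdd {n r : ℕ} (σ : Equiv.Perm (Fin n)) (τ : Equiv.Perm (Fin r)) (i : Fin r) :
    blockPerm σ τ (Fin.natAdd n i) = Fin.natAdd n (τ i) := by
  simp [blockPerm]

theorem exists_blockPerm {n r : ℕ} (π : Equiv.Perm (Fin (n + r)))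
    (h : ∀ a b, π (Fin.natAdd n a) ≠ Fin.castAdd r b) : ∃ σ τ, blockPerm σ τ = π := by
  have h1 : (finSumFinEquiv.symm.permCongr π) ∈ (Equiv.Perm.sumCongrHom (Fin n) (Fin r)).range := by
    have h2 : Set.MapsTo (finSumFinEquiv.symm.permCongr π)
        (Set.range (Sum.inr : Fin r → Fin n ⊕ Fin r)) (Set.range Sum.inr) := by
      rintro _ ⟨a, rfl⟩
      induction hx : π (Fin.natAdd n a) using Fin.addCases with
      | left b => exact absurd hx (h a b)
      | right b => exact ⟨b, by simp [Equiv.permCongr_apply, hx]⟩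
    exact Equiv.Perm.mem_sumCongrHom_range_of_perm_mapsTo_inl
      ((Equiv.Perm.perm_mapsTo_inl_iff_mapsTo_inr _).2 h2)
  obtain ⟨⟨σ, τ⟩, hστ⟩ := h1
  refine ⟨σ, τ, ?_⟩
  rw [blockPerm]
  change finSumFinEquiv.permCongr (Equiv.Perm.sumCongrHom (Fin n) (Fin r) (σ, τ)) = π
  rw [hστ]
  ext x
  simp [Equiv.permCongr_apply]

theorem colDet_of_block_lower {n r : ℕ} (M : Matrix (Fin (n + r)) (Fin (n + r)) S)
    (h : ∀ i j, M (Fin.castAdd r i) (Fin.natAdd n j) = 0) :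
    colDet M = colDet (M.submatrix (Fin.castAdd r) (Fin.castAdd r)) *
      colDet (M.submatrix (Fin.natAdd n) (Fin.natAdd n)) := by
  simp only [colDet, Finset.sum_mul_sum, ← Finset.sum_product', Finset.univ_product_univ]
  symm
  refine Finset.sum_of_injOn (fun p => blockPerm p.1 p.2) ?_ (by simp) ?_ ?_
  · rintro ⟨σ, τ⟩ - ⟨σ', τ'⟩ - hst
    have h1 := fun i => congrArg (fun f : Equiv.Perm _ => f (Fin.castAdd r i)) hst
    have h2 := fun i => congrArg (fun f : Equiv.Perm _ => f (Fin.natAdd n i)) hst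
    simp only [blockPerm_castAdd, blockPerm_natAdd] at h1 h2
    refine Prod.ext (Equiv.ext fun i => ?_) (Equiv.ext fun i => ?_)
    · exact Fin.castAdd_injective _ _ (h1 i)
    · exact Fin.natAdd_injective _ _ (h2 i)
  · intro π _ hπ
    obtain ⟨a, b, hab⟩ : ∃ a b, π (Fin.natAdd n a) = Fin.castAdd r b := by
      by_contra! hc
      obtain ⟨σ, τ, hst⟩ := exists_blockPerm π hc
      exact hπ ⟨(σ, τ), by simp, hst⟩
    rw [List.prod_eq_zero, smul_zero]
    exact List.mem_ofFn.2 ⟨Fin.natAdd n a, by simp only [hab, h]⟩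
  · rintro ⟨σ, τ⟩ -
    have hs : (Equiv.Perm.sign (blockPerm σ τ)) = Equiv.Perm.sign σ * Equiv.Perm.sign τ := by
      rw [blockPerm, Equiv.Perm.sign_permCongr, Equiv.Perm.sign_sumCongr]
    rw [hs, ofFn_append_parts, List.prod_append]
    simp only [blockPerm_castAdd, blockPerm_natAdd, Matrix.submatrix_apply, Units.val_mul,
      smul_mul_assoc, mul_smul_comm, mul_smul]
    rw [smul_comm]

end ColDet

/-! ### Manin matrices -/

section Manin

/-- A Manin matrix: the cross commutators `[M i k, M j l]` and `[M j k, M i l]` agree. The case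
`k = l` says, where `2` is invertible, that the entries of each column commute. -/
def IsManin {ι κ S : Type*} [Ring S] (M : Matrix ι κ S) : Prop :=
  ∀ i j k l, M i k * M j l + M i l * M j k = M j l * M i k + M j k * M i l

theorem IsManin.submatrix {ι κ ι' κ' S : Type*} [Ring S] {M : Matrix ι κ S} (h : IsManin M)
    (ρ : ι' → ι) (γ : κ' → κ) : IsManin (M.submatrix ρ γ) :=
  fun i j k l => h (ρ i) (ρ j) (γ k) (γ l)

/-- The Manin condition only involves commutators, so it is insensitive to central constants. -/
theorem IsManin.const_sub {ι κ S : Type*} [Ring S] {M : Matrix ι κ S} (h : IsManin M)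
    {Z : Matrix ι κ S} (hZ : ∀ i k s, Commute (Z i k) s) : IsManin (Z - M) := by
  intro i j k l
  have e1 := (hZ i k (Z j l - M j l)).eq
  have e2 := (hZ i l (Z j k - M j k)).eq
  have e3 := (hZ j l (M i k)).eq
  have e4 := (hZ j k (M i l)).eq
  have e := h i j k l
  simp only [Matrix.sub_apply]
  have l1 : (Z i k - M i k) * (Z j l - M j l) - (Z j l - M j l) * (Z i k - M i k) =
      M i k * M j l - M j l * M i k := by
    rw [sub_mul, e1, mul_sub (M i k), ← e3]
    noncomm_ring
  have l2 : (Z i l - M i l) * (Z j k - M j k) - (Z j k - M j k) * (Z i l - M i l) =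
      M i l * M j k - M j k * M i l := by
    rw [sub_mul, e2, mul_sub (M i l), ← e4]
    noncomm_ring
  have l3 := congrArg₂ (· + ·) l1 l2
  beta_reduce at l3
  have e' : M i k * M j l - M j l * M i k + (M i l * M j k - M j k * M i l) = 0 := by
    rw [sub_add_sub_comm, e, sub_self]
  rw [e', sub_add_sub_comm, sub_eq_zero] at l3
  exact l3

theorem IsManin.one_sub {m : ℕ} {S : Type*} [Ring S] {T : Matrix (Fin m) (Fin m) S}
    (hT : IsManin T) : IsManin (1 - T) := by
  refine hT.const_sub fun i k s => ?_
  rw [Matrix.one_apply]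
  split_ifs
  · exact Commute.one_left s
  · exact Commute.zero_left s

end Manin

/-! ### The exterior algebra over a noncommutative ring -/

section AntiCommute

variable {E : Type*} [Ring E]

theorem prod_mul_of_anticommute (y : E) (l : List E) (h : ∀ a ∈ l, a * y = -(y * a)) :
    l.prod * y = (-1) ^ l.length * (y * l.prod) := by
  induction l with
  | nil => simp
  | cons a l ih =>
    simp only [List.mem_cons, forall_eq_or_imp] at h
    rw [List.prod_cons, mul_assoc, ih h.2, List.length_cons, pow_succ]
    have := (Commute.neg_one_left a).pow_left l.length
    rw [← mul_assoc, ← this.eq, mul_assoc, ← mul_assoc a, h.1]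
    noncomm_ring

theorem prod_mul_prod_of_anticommute (l l' : List E)
    (h : ∀ a ∈ l, ∀ b ∈ l', a * b = -(b * a)) :
    l.prod * l'.prod = ((-1) ^ l.length) ^ l'.length * (l'.prod * l.prod) := by
  induction l' with
  | nil => simp
  | cons b l' ih =>
    simp only [List.mem_cons, forall_eq_or_imp] at h
    rw [List.prod_cons, ← mul_assoc, prod_mul_of_anticommute b l fun a ha => (h a ha).1,
      mul_assoc, mul_assoc, ih fun a ha => (h a ha).2, List.length_cons, pow_succ']
    have := (((Commute.neg_one_left b).pow_left l.length).pow_left l'.length).eq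
    rw [← mul_assoc b, ← this]
    noncomm_ring

theorem prod_mul_eq_zero_of_mem {y : E} {l : List E} (hy : y ∈ l) (hyy : y * y = 0)
    (h : ∀ a ∈ l, a * y = -(y * a)) : l.prod * y = 0 := by
  obtain ⟨s, t, rfl⟩ := List.append_of_mem hy
  rw [List.prod_append, List.prod_cons, mul_assoc, mul_assoc,
    prod_mul_of_anticommute y t fun a ha => h a (by simp [ha])]
  have := (((Commute.neg_one_left y).pow_left t.length)).eq
  rw [← mul_assoc y, ← this, mul_assoc _ y, ← mul_assoc y y, hyy]
  simp

end AntiCommute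

section Exterior

variable {S : Type*} [Ring S] [Algebra ℂ S] {m : ℕ}

/-- The odd element `∑ i, c i ⊗ ψ i` attached to a column vector `c`, where the `ψ i` are the
standard generators of the exterior algebra. -/
noncomputable def oddVec (c : Fin m → S) : S ⊗[ℂ] ExteriorAlgebra ℂ (Fin m → ℂ) :=
  ∑ i, c i ⊗ₜ[ℂ] ExteriorAlgebra.ι ℂ (Pi.single i 1)

theorem oddVec_add (c d : Fin m → S) : oddVec (c + d) = oddVec c + oddVec d := by
  simp [oddVec, TensorProduct.add_tmul, Finset.sum_add_distrib]

theorem oddVec_sum {α : Type*} (s : Finset α) (c : α → Fin m → S) :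
    oddVec (∑ a ∈ s, c a) = ∑ a ∈ s, oddVec (c a) := by
  simp only [oddVec, Finset.sum_apply, TensorProduct.sum_tmul]
  exact Finset.sum_comm

theorem oddVec_mul (c : Fin m → S) (s : S) :
    oddVec (fun i => c i * s) = oddVec c * (s ⊗ₜ 1) := by
  simp [oddVec, Finset.sum_mul]

/-- The columns of a Manin matrix give pairwise anticommuting odd elements. -/
theorem oddVec_mul_oddVec {κ : Type*} {M : Matrix (Fin m) κ S} (hM : IsManin M) (k l : κ) :
    oddVec (fun i => M i k) * oddVec (fun i => M i l) =
      -(oddVec (fun i => M i l) * oddVec (fun i => M i k)) := by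
  rw [eq_neg_iff_add_eq_zero]
  set X := oddVec (fun i => M i k) * oddVec (fun i => M i l) +
    oddVec (fun i => M i l) * oddVec (fun i => M i k) with hX
  have e : X = ∑ i, ∑ j, (M i k * M j l + M i l * M j k) ⊗ₜ[ℂ]
      (ExteriorAlgebra.ι ℂ (Pi.single i (1 : ℂ) : Fin m → ℂ) *
        ExteriorAlgebra.ι ℂ (Pi.single j (1 : ℂ) : Fin m → ℂ)) := by
    simp only [hX, oddVec, Finset.sum_mul_sum, Algebra.TensorProduct.tmul_mul_tmul,
      TensorProduct.add_tmul, Finset.sum_add_distrib]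
  have e' : X = -X := by
    conv_rhs => rw [e, Finset.sum_comm]
    rw [e, ← Finset.sum_neg_distrib]
    refine Finset.sum_congr rfl fun i _ => ?_
    rw [← Finset.sum_neg_distrib]
    refine Finset.sum_congr rfl fun j _ => ?_
    rw [eq_neg_of_add_eq_zero_left (ExteriorAlgebra.ι_add_mul_swap _ _), TensorProduct.tmul_neg,
      hM i j k l, add_comm (M j l * M i k)]
  have e2 : (2 : ℂ) • X = 0 := by
    rw [two_smul]
    nth_rewrite 1 [e']
    simp
  exact (smul_eq_zero.1 e2).resolve_left two_ne_zero

theorem oddVec_mul_self {κ : Type*} {M : Matrix (Fin m) κ S} (hM : IsManin M) (k : κ) :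
    oddVec (fun i => M i k) * oddVec (fun i => M i k) = 0 := by
  have e := oddVec_mul_oddVec hM k k
  have e2 : (2 : ℂ) • (oddVec (fun i => M i k) * oddVec (fun i => M i k)) = 0 := by
    rw [two_smul]
    nth_rewrite 1 [e]
    simp
  exact (smul_eq_zero.1 e2).resolve_left two_ne_zero

/-- The functional on the exterior algebra of `ℂ ^ m` that reads off the coefficient of
`ψ 0 * ⋯ * ψ (m - 1)`. -/
noncomputable def topForm (m : ℕ) : ExteriorAlgebra ℂ (Fin m → ℂ) →ₗ[ℂ] ℂ :=
  ExteriorAlgebra.liftAlternating fun k =>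
    if h : k = m then Matrix.detRowAlternating.domDomCongr (finCongr h.symm) else 0

theorem topForm_prod (h : Fin m → Fin m) :
    topForm m (List.ofFn fun p => ExteriorAlgebra.ι ℂ (Pi.single (h p) (1 : ℂ) : Fin m → ℂ)).prod =
      Matrix.det (Matrix.of fun p => (Pi.single (h p) (1 : ℂ) : Fin m → ℂ)) := by
  rw [← ExteriorAlgebra.ιMulti_apply, topForm, ExteriorAlgebra.liftAlternating_apply_ιMulti]
  simp only [dite_true, finCongr_refl]
  rfl

/-- The coefficient of the top product of generators, over the noncommutative ring `S`. -/
noncomputable def topCoeff : S ⊗[ℂ] ExteriorAlgebra ℂ (Fin m → ℂ) →ₗ[ℂ] S :=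
  (TensorProduct.rid ℂ S).toLinearMap ∘ₗ TensorProduct.map LinearMap.id (topForm m)

theorem topCoeff_tmul (s : S) (t : ExteriorAlgebra ℂ (Fin m → ℂ)) :
    topCoeff (s ⊗ₜ[ℂ] t) = topForm m t • s := by
  simp [topCoeff]

theorem prod_ofFn_tmul {B : Type*} [Ring B] [Algebra ℂ B] {k : ℕ} (s : Fin k → S) (t : Fin k → B) :
    (List.ofFn fun p => s p ⊗ₜ[ℂ] t p).prod = (List.ofFn s).prod ⊗ₜ[ℂ] (List.ofFn t).prod := by
  induction k with
  | zero => simp [Algebra.TensorProduct.one_def]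
  | succ k ih => simp [List.ofFn_succ, ih]

/-- The column determinant is the top coefficient of the product of the odd elements attached to
the columns. -/
theorem topCoeff_prod_oddVec (M : Matrix (Fin m) (Fin m) S) :
    topCoeff (List.ofFn fun p => oddVec fun i => M i p).prod = colDet M := by
  simp only [oddVec]
  rw [← MultilinearMap.mkPiAlgebraFin_apply (R := ℂ), MultilinearMap.map_sum]
  simp only [MultilinearMap.mkPiAlgebraFin_apply, prod_ofFn_tmul, map_sum, topCoeff_tmul,
    topForm_prod]
  symm
  refine Finset.sum_of_injOn (fun σ : Equiv.Perm (Fin m) => (σ : Fin m → Fin m)) ?_ (by simp) ?_ ?_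
  · exact fun σ _ τ _ h => DFunLike.coe_injective h
  · intro h _ hh
    have hinj : ¬ Function.Injective h := fun hi =>
      hh ⟨Equiv.ofBijective h (Finite.injective_iff_bijective.1 hi), by simp, rfl⟩
    simp only [Function.Injective, not_forall] at hinj
    obtain ⟨a, b, hab, hne⟩ := hinj
    rw [Matrix.det_zero_of_row_eq hne (congrArg (fun c => Pi.single c (1 : ℂ)) hab), zero_smul]
  · intro σ _
    have e : (Matrix.of fun p => (Pi.single (σ p) (1 : ℂ) : Fin m → ℂ)) =
        (1 : Matrix (Fin m) (Fin m) ℂ).submatrix σ id := by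
      ext a b
      change (Pi.single (σ a) (1 : ℂ) : Fin m → ℂ) b = (1 : Matrix (Fin m) (Fin m) ℂ) (σ a) b
      rw [Matrix.one_apply, Pi.single_apply]
      simp only [eq_comm]
    rw [e, Matrix.det_permute, Matrix.det_one, mul_one, Int.cast_smul_eq_zsmul]

end Exterior

/-! ### The Schur complement -/

/-- **Schur complement formula** for the column determinant of a Manin matrix. The corner need only
have a right inverse. -/
theorem IsManin.colDet_eq_mul_schur {S : Type*} [Ring S] [Algebra ℂ S] {n r : ℕ}
    {M : Matrix (Fin (n + r)) (Fin (n + r)) S} (hM : IsManin M) {N : Matrix (Fin n) (Fin n) S}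
    (hN : corner n r M * N = 1) {C : Matrix (Fin r) (Fin r) S}
    (hC : ∀ i j, C i j = M (Fin.natAdd n i) (Fin.natAdd n j) -
      ∑ k, M (Fin.natAdd n i) (Fin.castAdd r k) *
        ∑ l, N k l * M (Fin.castAdd r l) (Fin.natAdd n j)) :
    colDet M = colDet (corner n r M) * colDet C := by
  set P : Matrix (Fin (n + r)) (Fin (n + r)) S := Matrix.of fun i j =>
    Fin.addCases (fun _ => M i j)
      (fun b => Fin.addCases (fun _ => 0) (fun a => C a b) i) j with hP
  have hP1 : ∀ i a, P i (Fin.castAdd r a) = M i (Fin.castAdd r a) := by simp [hP]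
  have hP2 : ∀ i a, P (Fin.castAdd r i) (Fin.natAdd n a) = 0 := by simp [hP]
  have hP3 : ∀ i a, P (Fin.natAdd n i) (Fin.natAdd n a) = C i a := by simp [hP]
  have key : colDet P = colDet (corner n r M) * colDet C := by
    rw [colDet_of_block_lower P hP2]
    congr 2
    · ext i j
      simp [corner, hP1]
    · ext i j
      simp [hP3]
  rw [← key, ← topCoeff_prod_oddVec, ← topCoeff_prod_oddVec]
  congr 1
  rw [ofFn_append_parts, ofFn_append_parts, List.prod_append, List.prod_append]
  simp only [hP1]
  set W := List.ofFn fun a : Fin n => oddVec fun i => M i (Fin.castAdd r a) with hW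
  -- Multiplied by `W.prod`, a column of `M` may be replaced by that of the block triangular matrix.
  have hcol : ∀ b : Fin r, W.prod * oddVec (fun i => M i (Fin.natAdd n b)) =
      W.prod * oddVec (fun i => P i (Fin.natAdd n b)) := by
    intro b
    have e : (fun i => M i (Fin.natAdd n b)) = (∑ k : Fin n, fun i => M i (Fin.castAdd r k) *
        ∑ l, N k l * M (Fin.castAdd r l) (Fin.natAdd n b)) + fun i => P i (Fin.natAdd n b) := by
      ext i
      rw [Pi.add_apply, Finset.sum_apply]
      induction i using Fin.addCases with
      | left i =>
        have e2 : corner n r M * (N * Matrix.of fun l b => M (Fin.castAdd r l) (Fin.natAdd n b)) =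
            Matrix.of fun l b => M (Fin.castAdd r l) (Fin.natAdd n b) := by
          rw [← Matrix.mul_assoc, hN, Matrix.one_mul]
        rw [hP2, add_zero]
        exact (congrFun₂ e2 i b).symm
      | right i => rw [hP3, hC]; abel
    rw [e, oddVec_add, oddVec_sum, mul_add, Finset.mul_sum, Finset.sum_eq_zero, zero_add]
    intro k _
    rw [oddVec_mul, ← mul_assoc, prod_mul_eq_zero_of_mem, zero_mul]
    · exact List.mem_ofFn.2 ⟨k, rfl⟩
    · exact oddVec_mul_self hM _
    · intro a ha
      obtain ⟨c, rfl⟩ := List.mem_ofFn.1 ha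
      exact oddVec_mul_oddVec hM _ _
  -- The columns are replaced from the right: the last one is moved next to `W.prod` by passing
  -- `W.prod` over the others, replaced there, and `W.prod` is moved back.
  have hind : ∀ l : List (Fin r),
      W.prod * (l.map fun b => oddVec fun i => M i (Fin.natAdd n b)).prod =
        W.prod * (l.map fun b => oddVec fun i => P i (Fin.natAdd n b)).prod := by
    intro l
    induction l using List.reverseRecOn with
    | nil => simp
    | append_singleton l b ih =>
      simp only [List.map_append, List.prod_append, List.map_singleton, List.prod_singleton]
      rw [← mul_assoc, ← mul_assoc, ← ih]
      rw [prod_mul_prod_of_anticommute, mul_assoc, mul_assoc, hcol, mul_assoc, mul_assoc]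
      intro a ha c hc
      obtain ⟨a', rfl⟩ := List.mem_ofFn.1 ha
      obtain ⟨c', -, rfl⟩ := List.mem_map.1 hc
      exact oddVec_mul_oddVec hM _ _
  simpa only [List.map_ofFn, Function.comp_def, List.ofFn_eq_map] using hind (List.finRange r)

end QSylvester

/-! ### Noncommutative power series -/

namespace NCPowerSeries

variable {X R : Type*} [Ring R]

theorem pow_apply_eq_zero {h : NCPowerSeries X R} (h0 : h [] = 0) (k : ℕ) (w : List X)
    (hk : w.length < k) : (h ^ k) w = 0 := by
  induction k generalizing w with
  | zero => omega
  | succ k ih =>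
    rw [pow_succ', mul_apply]
    refine Finset.sum_eq_zero fun t ht => ?_
    rcases Nat.eq_zero_or_pos t with rfl | ht'
    · simp [h0]
    · rw [Finset.mem_range] at ht
      rw [ih, mul_zero]
      rw [List.length_drop]
      omega

/-- A power series with constant coefficient `1` is invertible: the geometric series is finite in
each coefficient. -/
theorem isUnit_of_apply_nil {f : NCPowerSeries X R} (hf : f [] = 1) : IsUnit f := by
  set h : NCPowerSeries X R := 1 - f with hh
  have h0 : h [] = 0 := by
    change (1 : NCPowerSeries X R) [] - f [] = 0
    rw [hf, one_apply]
    simp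
  have sub_pow_apply : ∀ w : List X, (1 - h ^ (w.length + 1) : NCPowerSeries X R) w =
      (1 : NCPowerSeries X R) w := by
    intro w
    change (1 : NCPowerSeries X R) w - (h ^ (w.length + 1)) w = _
    rw [pow_apply_eq_zero h0 _ _ (Nat.lt_succ_self _), sub_zero]
  set g : NCPowerSeries X R := fun w => (∑ k ∈ Finset.range (w.length + 1), h ^ k) w with hg
  have hgN : ∀ (w : List X) (N : ℕ), w.length + 1 ≤ N → g w = (∑ k ∈ Finset.range N, h ^ k) w := by
    intro w N hN
    obtain ⟨d, rfl⟩ := Nat.exists_eq_add_of_le hN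
    induction d with
    | zero => rfl
    | succ d ih =>
      rw [← add_assoc, Finset.sum_range_succ, add_apply, ← ih (Nat.le_add_right _ _),
        pow_apply_eq_zero h0 _ _ (by omega), add_zero]
  have hf' : f = 1 - h := by rw [hh]; abel
  refine ⟨⟨f, g, ?_, ?_⟩, rfl⟩
  · ext w
    rw [← sub_pow_apply w, ← mul_neg_geom_sum, ← hf', mul_apply, mul_apply]
    refine Finset.sum_congr rfl fun k hk => ?_
    rw [hgN]
    rw [List.length_drop]
    omega
  · ext w
    rw [← sub_pow_apply w, ← geom_sum_mul_neg, ← hf', mul_apply, mul_apply]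
    refine Finset.sum_congr rfl fun k hk => ?_
    rw [hgN]
    rw [List.length_take]
    omega

theorem var_mul_nil (y : X) (F : NCPowerSeries X R) : (var y * F : NCPowerSeries X R) [] = 0 := by
  simp [mul_apply, var, word]

open Classical in
theorem var_mul_cons (y x : X) (w : List X) (F : NCPowerSeries X R) :
    (var y * F : NCPowerSeries X R) (x :: w) = if x = y then F w else 0 := by
  rw [mul_apply, Finset.sum_eq_single 1]
  · simp [var, word]
  · intro k hk hk1
    rw [Finset.mem_range] at hk
    rw [var, word, if_neg, zero_mul]
    intro h
    have := congrArg List.length h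
    rw [List.length_take, List.length_singleton] at this
    omega
  · simp

end NCPowerSeries

namespace QSylvester

/-! ### A Heisenberg group -/

section Heisenberg

variable {ι : Type*} [Fintype ι]

/-- The bicharacter of the lattice `ℤ ^ ι` with values `p i j` on pairs of basis vectors. -/
def bichar (p : ι → ι → ℂˣ) (v w : ι → ℤ) : ℂˣ := ∏ i, ∏ j, p i j ^ (v i * w j)

variable (p : ι → ι → ℂˣ)

theorem bichar_add_left (v v' w : ι → ℤ) :
    bichar p (v + v') w = bichar p v w * bichar p v' w := by
  simp [bichar, add_mul, zpow_add, Finset.prod_mul_distrib]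

theorem bichar_add_right (v w w' : ι → ℤ) :
    bichar p v (w + w') = bichar p v w * bichar p v w' := by
  simp [bichar, mul_add, zpow_add, Finset.prod_mul_distrib]

theorem bichar_zero_left (w : ι → ℤ) : bichar p 0 w = 1 := by simp [bichar]

theorem bichar_zero_right (v : ι → ℤ) : bichar p v 0 = 1 := by simp [bichar]

theorem bichar_neg_left (v w : ι → ℤ) : bichar p (-v) w = (bichar p v w)⁻¹ := by
  simp [bichar]

theorem bichar_single [DecidableEq ι] (a b : ι) :
    bichar p (Pi.single a 1) (Pi.single b 1) = p a b := by
  rw [bichar, Finset.prod_eq_single a, Finset.prod_eq_single b]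
  · simp
  · intro j _ hj
    simp [hj]
  · simp
  · intro i _ hi
    simp [hi]
  · simp

/-- The central extension of `ℤ ^ ι` by `ℂˣ` with cocycle `bichar p`: the group of monomials of a
quantum torus. -/
@[ext]
structure Heis (p : ι → ι → ℂˣ) where
  /-- The scalar part. -/
  scalar : ℂˣ
  /-- The exponent vector. -/
  expo : ι → ℤ

namespace Heis

variable {p}

instance : Mul (Heis p) :=
  ⟨fun g h => ⟨g.scalar * h.scalar * bichar p g.expo h.expo, g.expo + h.expo⟩⟩

instance : One (Heis p) := ⟨⟨1, 0⟩⟩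

instance : Inv (Heis p) := ⟨fun g => ⟨g.scalar⁻¹ * bichar p g.expo g.expo, -g.expo⟩⟩

theorem mul_scalar (g h : Heis p) :
    (g * h).scalar = g.scalar * h.scalar * bichar p g.expo h.expo := rfl

theorem mul_expo (g h : Heis p) : (g * h).expo = g.expo + h.expo := rfl

instance : Group (Heis p) :=
  Group.ofLeftAxioms
    (fun a b c => by
      refine Heis.ext ?_ (add_assoc _ _ _)
      simp only [mul_scalar, mul_expo, bichar_add_left, bichar_add_right]
      ac_rfl)
    (fun a => by
      refine Heis.ext ?_ (zero_add _)
      change 1 * a.scalar * bichar p 0 a.expo = _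
      rw [bichar_zero_left, mul_one, one_mul])
    (fun a => by
      refine Heis.ext ?_ (neg_add_cancel _)
      change a.scalar⁻¹ * bichar p a.expo a.expo * a.scalar * bichar p (-a.expo) a.expo = 1
      rw [bichar_neg_left]
      group
      simp)

/-- The central subgroup of scalars. -/
def ofScalar : ℂˣ →* Heis p where
  toFun c := ⟨c, 0⟩
  map_one' := rfl
  map_mul' a b := by
    refine Heis.ext ?_ (zero_add _).symm
    change a * b = a * b * bichar p 0 0
    rw [bichar_zero_left, mul_one]

theorem ofScalar_mul (c : ℂˣ) (g : Heis p) : ofScalar c * g = ⟨c * g.scalar, g.expo⟩ := by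
  refine Heis.ext ?_ (zero_add _)
  change c * g.scalar * bichar p 0 _ = _
  rw [bichar_zero_left, mul_one]

theorem mul_ofScalar (c : ℂˣ) (g : Heis p) : g * ofScalar c = ofScalar c * g := by
  rw [ofScalar_mul]
  refine Heis.ext ?_ (add_zero _)
  change g.scalar * c * bichar p _ 0 = _
  rw [bichar_zero_right, mul_one, mul_comm]

/-- The generator `x i` of the Heisenberg group. -/
def gen [DecidableEq ι] (i : ι) : Heis p := ⟨1, Pi.single i 1⟩

theorem gen_mul_gen [DecidableEq ι] (i j : ι) :
    (gen j * gen i : Heis p) = ofScalar (p j i * (p i j)⁻¹) * (gen i * gen j) := by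
  rw [ofScalar_mul]
  refine Heis.ext ?_ (add_comm _ _)
  simp only [mul_scalar, gen, bichar_single]
  simp

/-- The scalar by which `g` and the generator `x k` commute. -/
def commFactor [DecidableEq ι] (k : ι) (g : Heis p) : ℂˣ :=
  bichar p g.expo (Pi.single k 1) * (bichar p (Pi.single k 1) g.expo)⁻¹

theorem mul_gen [DecidableEq ι] (k : ι) (g : Heis p) :
    g * gen k = ofScalar (commFactor k g) * (gen k * g) := by
  rw [ofScalar_mul]
  refine Heis.ext ?_ (add_comm _ _)
  simp only [mul_scalar, gen, commFactor]
  simp only [mul_one, one_mul]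
  generalize bichar p g.expo (Pi.single k 1) = a
  generalize bichar p (Pi.single k 1) g.expo = b
  rw [mul_comm (a * b⁻¹), mul_assoc, mul_comm a, mul_inv_cancel_left]

theorem commFactor_ofScalar_mul [DecidableEq ι] (k : ι) (c : ℂˣ) (g : Heis p) :
    commFactor k (ofScalar c * g) = commFactor k g := by
  rw [ofScalar_mul, commFactor, commFactor]

end Heis

end Heisenberg

/-! ### Twisting by the Heisenberg group -/

section Twist

variable {ι : Type*} [Fintype ι] {p : ι → ι → ℂˣ}
  {S : Type*} [Ring S] [Algebra ℂ S]

open Heis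

/-- The `S`-valued functions on the Heisenberg group that are homogeneous under its scalars. -/
def equivariant (p : ι → ι → ℂˣ) (S : Type*) [Ring S] [Algebra ℂ S] :
    Submodule ℂ (Heis p → S) where
  carrier := {f | ∀ (c : ℂˣ) g, f (ofScalar c * g) = (c : ℂ) • f g}
  add_mem' hf hg c g := by
    simp only [Pi.add_apply, smul_add]
    rw [hf, hg]
  zero_mem' c g := by simp
  smul_mem' a f hf c g := by
    simp only [Pi.smul_apply]
    rw [hf, smul_comm]

theorem equivariant_apply (f : equivariant p S) (c : ℂˣ) (g : Heis p) :
    (f : Heis p → S) (ofScalar c * g) = (c : ℂ) • (f : Heis p → S) g := f.2 c g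

/-- The homogeneous function that sends `g` to its scalar part. -/
def baseFn : equivariant p S :=
  ⟨fun g => (g.scalar : ℂ) • 1, fun c g => by
    beta_reduce
    rw [ofScalar_mul, smul_smul, Units.val_mul]⟩

theorem baseFn_one : (baseFn : equivariant p S).1 1 = 1 := by
  change ((1 : ℂˣ) : ℂ) • (1 : S) = 1
  simp

/-- The ring of linear operators on the homogeneous functions. -/
def TwistRing (p : ι → ι → ℂˣ) (S : Type*) [Ring S] [Algebra ℂ S] : Type _ :=
  Module.End ℂ (equivariant p S)

noncomputable instance : Ring (TwistRing p S) :=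
  inferInstanceAs (Ring (Module.End ℂ (equivariant p S)))

noncomputable instance : Algebra ℂ (TwistRing p S) :=
  inferInstanceAs (Algebra ℂ (Module.End ℂ (equivariant p S)))

namespace TwistRing

/-- The action of an operator on a function. -/
def act (T : TwistRing p S) (f : equivariant p S) : equivariant p S :=
  (show Module.End ℂ (equivariant p S) from T) f

/-- The value at `g` of an operator applied to `f`, as a linear function of the operator. -/
def ev (f : equivariant p S) (g : Heis p) : TwistRing p S →ₗ[ℂ] S where
  toFun T := (act T f).1 g
  map_add' _ _ := rfl
  map_smul' _ _ := rfl

theorem act_apply (T : TwistRing p S) (f : equivariant p S) (g : Heis p) :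
    (act T f).1 g = ev f g T := rfl

theorem ev_one (f : equivariant p S) (g : Heis p) : ev f g 1 = f.1 g := rfl

theorem ev_mul (f : equivariant p S) (g : Heis p) (T U : TwistRing p S) :
    ev f g (T * U) = ev (act U f) g T := rfl

theorem ext_ev {T U : TwistRing p S} (h : ∀ f g, ev f g T = ev f g U) : T = U :=
  LinearMap.ext fun f => Subtype.ext (funext fun g => h f g)

end TwistRing

open TwistRing

/-- The operator `f ↦ (g ↦ Y g * f (b⁻¹ * g * a))`. -/
def shiftOp (Y : Heis p → S) (hY : ∀ c g, Y (ofScalar c * g) = Y g) (a b : Heis p) :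
    TwistRing p S :=
  show equivariant p S →ₗ[ℂ] equivariant p S from
  { toFun := fun f => ⟨fun g => Y g * f.1 (b⁻¹ * g * a), fun c g => by
      have e : b⁻¹ * (ofScalar c * g) * a = ofScalar c * (b⁻¹ * g * a) := by
        rw [← mul_assoc b⁻¹, mul_ofScalar]
        simp only [mul_assoc]
      beta_reduce
      rw [hY, e, equivariant_apply, mul_smul_comm]⟩
    map_add' := fun f f' => by
      ext g
      simp [mul_add]
    map_smul' := fun c f => by
      ext g
      simp }

variable [LinearOrder ι]

/-- The twisted matrix: its `(i, k)` entry multiplies by `A i k` and moves the argument `g` to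
`(x k)⁻¹ * g * x i`. -/
def twist (p : ι → ι → ℂˣ) (A : Matrix ι ι S) : Matrix ι ι (TwistRing p S) :=
  Matrix.of fun i k => shiftOp (fun _ => A i k) (fun _ _ => rfl) (gen i) (gen k)

theorem ev_twist (A : Matrix ι ι S) (i k : ι) (f : equivariant p S) (g : Heis p) :
    ev f g (twist p A i k) = A i k * f.1 ((gen k)⁻¹ * g * gen i) := rfl

theorem apply_conj_swap_col (g : Heis p) (i j k l : ι) (f : equivariant p S) :
    f.1 ((gen l)⁻¹ * ((gen k)⁻¹ * g * gen i) * gen j) =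
      ((p l k * (p k l)⁻¹ : ℂˣ) : ℂ) • f.1 ((gen k)⁻¹ * ((gen l)⁻¹ * g * gen i) * gen j) := by
  rw [← equivariant_apply]
  refine congrArg f.1 ?_
  have e : ((gen l)⁻¹ * (gen k)⁻¹ : Heis p) =
      ofScalar (p l k * (p k l)⁻¹) * ((gen k)⁻¹ * (gen l)⁻¹) := by
    have e0 := gen_mul_gen (p := p) l k
    rw [← mul_inv_rev, ← mul_inv_rev, e0, mul_inv_rev, ← map_inv, mul_ofScalar]
    simp
  calc (gen l)⁻¹ * ((gen k)⁻¹ * g * gen i) * gen j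
      = ((gen l)⁻¹ * (gen k)⁻¹) * (g * gen i * gen j) := by simp only [mul_assoc]
    _ = _ := by rw [e]; simp only [mul_assoc]

theorem apply_conj_swap_row (g : Heis p) (i j k l : ι) (f : equivariant p S) :
    f.1 ((gen l)⁻¹ * ((gen k)⁻¹ * g * gen j) * gen i) =
      ((p j i * (p i j)⁻¹ : ℂˣ) : ℂ) • f.1 ((gen l)⁻¹ * ((gen k)⁻¹ * g * gen i) * gen j) := by
  rw [← equivariant_apply]
  refine congrArg f.1 ?_
  calc (gen l)⁻¹ * ((gen k)⁻¹ * g * gen j) * gen i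
      = ((gen l)⁻¹ * (gen k)⁻¹ * g) * (gen j * gen i) := by simp only [mul_assoc]
    _ = _ := by
      rw [gen_mul_gen, ← mul_assoc, mul_ofScalar]
      simp only [mul_assoc]

/-- Twisting by a Heisenberg group whose commutation factors are the parameters `q i j` turns a
`q`-right-quantum matrix into a Manin matrix. -/
theorem isManin_twist {q : ι → ι → ℂ} (hp : ∀ i j, i < j → (p i j : ℂ) = q i j)
    (hp' : ∀ i j, i < j → p j i = 1) {A : Matrix ι ι S} (hA : IsRightQuantum q A) :
    IsManin (twist p A) := by
  have key1 : ∀ i j k, i < j → twist p A i k * twist p A j k = twist p A j k * twist p A i k := by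
    intro i j k hij
    refine ext_ev fun f g => ?_
    simp only [ev_mul, ev_twist, act_apply]
    rw [apply_conj_swap_row g i j k k, mul_smul_comm, mul_smul_comm, ← mul_assoc (A i k),
      ← mul_assoc (A j k), hA.1 i j k hij, hp' i j hij, smul_mul_assoc, smul_smul, Units.val_mul,
      Units.val_inv_eq_inv_val, ← hp i j hij]
    simp
  have key2 : ∀ i j k l, i < j → k < l →
      twist p A i k * twist p A j l + twist p A i l * twist p A j k =
        twist p A j l * twist p A i k + twist p A j k * twist p A i l := by
    intro i j k l hij hkl
    refine ext_ev fun f g => ?_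
    set F := f.1 ((gen l)⁻¹ * ((gen k)⁻¹ * g * gen i) * gen j) with hF
    have h1 : f.1 ((gen k)⁻¹ * ((gen l)⁻¹ * g * gen i) * gen j) = _ • F :=
      apply_conj_swap_col g i j l k f
    have h2 : f.1 ((gen l)⁻¹ * ((gen k)⁻¹ * g * gen j) * gen i) = _ • F :=
      apply_conj_swap_row g i j k l f
    have h3 : f.1 ((gen k)⁻¹ * ((gen l)⁻¹ * g * gen j) * gen i) = _ :=
      apply_conj_swap_row g i j l k f
    rw [h1] at h3
    simp only [hp' i j hij, hp' k l hkl, one_mul, mul_one, inv_one, Units.val_inv_eq_inv_val,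
      hp i j hij, hp k l hkl] at h1 h2 h3
    have hrel := congrArg (· * F) (hA.2 i j k l hij hkl)
    simp only [sub_mul, smul_mul_assoc, mul_assoc] at hrel
    simp only [map_add, ev_mul, ev_twist, act_apply]
    rw [h1, h2, h3]
    simp only [mul_smul_comm, smul_smul]
    rw [sub_eq_sub_iff_add_eq_add] at hrel
    rw [mul_comm (q i j)⁻¹ (q k l)]
    exact hrel
  have key3 : ∀ i j k l, i < j →
      twist p A i k * twist p A j l + twist p A i l * twist p A j k =
        twist p A j l * twist p A i k + twist p A j k * twist p A i l := by
    intro i j k l hij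
    rcases lt_trichotomy k l with h | rfl | h
    · exact key2 i j k l hij h
    · rw [key1 i j k hij]
    · have := key2 i j l k hij h
      rw [add_comm, this, add_comm]
  intro i j k l
  rcases lt_trichotomy i j with h | rfl | h
  · exact key3 i j k l h
  · exact add_comm _ _
  · rw [add_comm (_ * _), add_comm (twist p A j l * _)]
    exact (key3 j i k l h).symm

end Twist

open Heis TwistRing

/-! ### The inverse of the twisted corner -/

section PathSeries

variable {ι κ : Type*} [Fintype ι] [LinearOrder ι] [Fintype κ] [DecidableEq κ]
  {p : ι → ι → ℂˣ} (e : κ → ι)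

open Classical in
/-- The coefficient of a word in the `(i, j)` entry, at the point `g`, of the inverse of `1` minus
the twisted matrix of variables with indices in the range of `e`: only words that trace a path from
`e i` to `e j` occur, and each intermediate index contributes the scalar by which it commutes with
the current point. -/
noncomputable def pathCoeff (j : κ) : List (ι × ι) → κ → Heis p → ℂ
  | [], i, g => if i = j then ((commFactor (e i) g)⁻¹ : ℂˣ) else 0
  | x :: w, i, g => ∑ k : κ, if x = (e i, e k) then
      (commFactor (e k) (g * gen (e i)) : ℂ) *
        pathCoeff j w k ((gen (e k))⁻¹ * g * gen (e i))
      else 0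

/-- The power series with coefficients `pathCoeff`. -/
noncomputable def pathSeries (i j : κ) (g : Heis p) : NCPowerSeries (ι × ι) ℂ :=
  fun w => pathCoeff e j w i g

theorem pathCoeff_ofScalar_mul (j : κ) (w : List (ι × ι)) (i : κ) (c : ℂˣ) (g : Heis p) :
    pathCoeff e j w i (ofScalar c * g) = pathCoeff e j w i g := by
  induction w generalizing i g with
  | nil => simp only [pathCoeff, commFactor_ofScalar_mul]
  | cons x w ih =>
    simp only [pathCoeff]
    refine Finset.sum_congr rfl fun k _ => ?_
    have h : (gen (e k))⁻¹ * (ofScalar c * g) * gen (e i) =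
        ofScalar c * ((gen (e k))⁻¹ * g * gen (e i)) := by
      rw [← mul_assoc (gen (e k))⁻¹, mul_ofScalar]
      simp only [mul_assoc]
    rw [h, ih, mul_assoc, commFactor_ofScalar_mul]

theorem pathSeries_eq (i j : κ) (g : Heis p) :
    pathSeries e i j g =
      (if i = j then (((commFactor (e i) g)⁻¹ : ℂˣ) : ℂ) else 0) • (1 : NCPowerSeries (ι × ι) ℂ) +
      ∑ k, (commFactor (e k) (g * gen (e i)) : ℂ) • (NCPowerSeries.var (e i, e k) *
        pathSeries e k j ((gen (e k))⁻¹ * g * gen (e i))) := by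
  classical
  have sum_apply : ∀ (F : κ → NCPowerSeries (ι × ι) ℂ) (w : List (ι × ι)),
      (∑ k, F k) w = ∑ k, F k w := fun F w => Finset.sum_apply w _ _
  ext w
  rw [NCPowerSeries.add_apply, sum_apply]
  simp only [NCPowerSeries.smul_apply]
  cases w with
  | nil =>
    simp only [NCPowerSeries.var_mul_nil, smul_zero, Finset.sum_const_zero, add_zero]
    simp [pathSeries, pathCoeff, NCPowerSeries.one_apply]
  | cons x w =>
    have h0 : (1 : NCPowerSeries (ι × ι) ℂ) (x :: w) = 0 := by
      simp [NCPowerSeries.one_apply]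
    rw [h0, smul_zero, zero_add]
    simp only [NCPowerSeries.var_mul_cons]
    refine Finset.sum_congr rfl fun k _ => ?_
    simp only [pathSeries, smul_eq_mul, mul_ite, mul_zero]

variable {S : Type*} [Ring S] [Algebra ℂ S] (φ : NCPowerSeries (ι × ι) ℂ →ₐ[ℂ] S)

/-- The matrix of operators given by the path series. -/
noncomputable def pathMatrix (p : ι → ι → ℂˣ) :
    Matrix κ κ (TwistRing p S) :=
  Matrix.of fun i j => shiftOp (fun g => φ (pathSeries e i j g))
    (fun c g => congrArg φ (funext fun w => pathCoeff_ofScalar_mul e j w i c g))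
    (gen (e i)) (gen (e j))

theorem one_sub_twist_mul_pathMatrix {A : Matrix ι ι S}
    (hA : ∀ i k, A i k = φ (NCPowerSeries.var (i, k))) :
    (1 - (twist p A).submatrix e e) * pathMatrix e φ p = 1 := by
  rw [Matrix.sub_mul, Matrix.one_mul, sub_eq_iff_eq_add]
  ext i j
  refine ext_ev fun f g => ?_
  have hsum : ev f g (((twist p A).submatrix e e * pathMatrix e φ p) i j) =
      ∑ k, A (e i) (e k) * (φ (pathSeries e k j ((gen (e k))⁻¹ * g * gen (e i))) *
        f.1 ((gen (e j))⁻¹ * ((gen (e k))⁻¹ * g * gen (e i)) * gen (e k))) := by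
    rw [Matrix.mul_apply, map_sum]
    rfl
  have hmove : ∀ k, f.1 ((gen (e j))⁻¹ * ((gen (e k))⁻¹ * g * gen (e i)) * gen (e k)) =
      (commFactor (e k) (g * gen (e i)) : ℂ) • f.1 ((gen (e j))⁻¹ * g * gen (e i)) := by
    intro k
    rw [← equivariant_apply]
    refine congrArg f.1 ?_
    calc (gen (e j))⁻¹ * ((gen (e k))⁻¹ * g * gen (e i)) * gen (e k)
        = (gen (e j))⁻¹ * (gen (e k))⁻¹ * ((g * gen (e i)) * gen (e k)) := by
          simp only [mul_assoc]
      _ = _ := by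
          rw [mul_gen, ← mul_assoc, mul_ofScalar]
          simp only [mul_assoc, inv_mul_cancel_left]
  have hone : ev f g ((1 : Matrix κ κ (TwistRing p S)) i j) =
      (if i = j then (((commFactor (e i) g)⁻¹ : ℂˣ) : ℂ) else 0) •
        f.1 ((gen (e j))⁻¹ * g * gen (e i)) := by
    rw [Matrix.one_apply]
    split_ifs with h
    · subst h
      have h2 : (gen (e i))⁻¹ * g * gen (e i) = ofScalar (commFactor (e i) g) * g := by
        rw [mul_assoc, mul_gen, ← mul_assoc, mul_ofScalar, mul_assoc, inv_mul_cancel_left]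
      rw [h2, equivariant_apply, smul_smul, Units.inv_mul, one_smul, ev_one]
    · simp
  have hN : ev f g (pathMatrix e φ p i j) =
      φ (pathSeries e i j g) * f.1 ((gen (e j))⁻¹ * g * gen (e i)) := rfl
  rw [Matrix.add_apply, map_add, hone, hsum, hN, pathSeries_eq, map_add,
    add_mul, map_smul, map_one, smul_mul_assoc, one_mul, map_sum, Finset.sum_mul]
  congr 1
  refine Finset.sum_congr rfl fun k _ => ?_
  rw [hmove, map_smul, map_mul, ← hA]
  simp only [smul_mul_assoc, mul_smul_comm, mul_assoc]

end PathSeries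
/-! ### Inversion weights -/

section InvUnit

variable {κ : Type*} [LinearOrder κ] (u : κ → κ → ℂˣ)

/-- The inversion weight `invWeight`, with values in the units. -/
def invUnit : List κ → ℂˣ
  | [] => 1
  | a :: ν => (ν.map fun b => if b < a then u b a else 1).prod * invUnit ν

theorem coe_invUnit {q : κ → κ → ℂ} (hu : ∀ i j, i < j → (u i j : ℂ) = q i j) (ν : List κ) :
    (invUnit u ν : ℂ) = invWeight q ν := by
  induction ν with
  | nil => rfl
  | cons a ν ih =>
    rw [invUnit, invWeight, Units.val_mul, ih]
    congr 1
    rw [← Units.coeHom_apply, map_list_prod, List.map_map]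
    refine congrArg List.prod (List.map_congr_left fun b _ => ?_)
    by_cases h : b < a
    · simp [h, hu b a h]
    · simp [h]

theorem invUnit_append_singleton (J : List κ) (a : κ) (h : ∀ b ∈ J, b < a) :
    invUnit u (J ++ [a]) = invUnit u J := by
  induction J with
  | nil => simp [invUnit]
  | cons b J ih =>
    have hb : ¬ a < b := (h b (by simp)).not_gt
    simp only [List.cons_append, invUnit, List.map_append, List.prod_append, List.map_singleton,
      List.prod_singleton, if_neg hb, mul_one, ih fun c hc => h c (by simp [hc])]

variable {ι : Type*} [Fintype ι] {p : ι → ι → ℂˣ}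

/-- Sorting a word in group elements that commute up to the scalars `u i j` costs exactly its
inversion weight. -/
theorem ofScalar_invUnit_mul_prod_of_perm {x : κ → Heis p}
    (hx : ∀ i j, i < j → x j * x i = ofScalar (u i j)⁻¹ * (x i * x j)) {l l' : List κ}
    (h : l.Perm l') :
    ofScalar (invUnit u l) * (l.map x).prod = ofScalar (invUnit u l') * (l'.map x).prod := by
  induction h with
  | nil => rfl
  | @cons a l l' h ih =>
    simp only [invUnit, map_mul, List.map_cons, List.prod_cons]
    rw [(h.map _).prod_eq, mul_assoc, mul_assoc, ← mul_assoc _ (x a), ← mul_ofScalar _ (x a),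
      mul_assoc (x a), ih, ← mul_assoc (x a), mul_ofScalar _ (x a), mul_assoc _ (x a)]
  | swap a b l =>
    simp only [invUnit, List.map_cons, List.prod_cons]
    have key : ofScalar (if a < b then u a b else 1) * (x b * x a) =
        ofScalar (if b < a then u b a else 1) * (x a * x b) := by
      rcases lt_trichotomy a b with h | rfl | h
      · rw [if_pos h, if_neg h.not_gt, hx a b h, ← mul_assoc, ← map_mul, mul_inv_cancel]
      · rfl
      · rw [if_pos h, if_neg h.not_gt, hx b a h, ← mul_assoc (ofScalar (u b a)), ← map_mul,
          mul_inv_cancel]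
    simp only [map_mul]
    generalize (List.map x l).prod = y
    generalize hA : (ofScalar (l.map fun c => if c < b then u c b else 1).prod : Heis p) = A
    generalize hB : (ofScalar (l.map fun c => if c < a then u c a else 1).prod : Heis p) = B
    generalize hC : (ofScalar (invUnit u l) : Heis p) = C
    have cA : ∀ g, g * A = A * g := by rw [← hA]; exact mul_ofScalar _
    have cB : ∀ g, g * B = B * g := by rw [← hB]; exact mul_ofScalar _
    have cC : ∀ g, g * C = C * g := by rw [← hC]; exact mul_ofScalar _
    have reg : ∀ s t z y A B : Heis p, (∀ g, g * A = A * g) → (∀ g, g * B = B * g) →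
        s * A * (B * C) * (t * (z * y)) = A * (B * C) * ((s * (t * z)) * y) := by
      intro s t z y A B cA cB
      rw [cA s, mul_assoc A s, ← mul_assoc s B C, cB s, mul_assoc B s C, cC s]
      simp only [mul_assoc]
    rw [reg _ _ _ _ _ _ cA cB, reg _ _ _ _ _ _ cB cA, key, ← mul_assoc A B C, cB A,
      mul_assoc B A C]
  | trans _ _ ih ih' => exact ih.trans ih'

theorem prod_eq_of_perm {x : κ → Heis p}
    (hx : ∀ i j, i < j → x j * x i = ofScalar (u i j)⁻¹ * (x i * x j)) {l l' : List κ}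
    (h : l.Perm l') :
    (l.map x).prod = ofScalar ((invUnit u l)⁻¹ * invUnit u l') * (l'.map x).prod := by
  rw [map_mul, mul_assoc, ← ofScalar_invUnit_mul_prod_of_perm u hx h, ← mul_assoc, ← map_mul,
    inv_mul_cancel, map_one, one_mul]

variable {S : Type*} [Ring S] [Algebra ℂ S]

/-- A word whose row and column indices differ only in their last letters acts, up to its weight,
like the product of those last letters, at points that commute with the common letters. -/
theorem apply_conj_eq_wordWeight_smul {q : κ → κ → ℂ}
    (hu : ∀ i j, i < j → (u i j : ℂ) = q i j) {x : κ → Heis p}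
    (hx : ∀ i j, i < j → x j * x i = ofScalar (u i j)⁻¹ * (x i * x j)) (f : equivariant p S)
    (g : Heis p) (w : FreeMonoid (κ × κ)) (J t t' : List κ)
    (ht : (w.toList.map Prod.fst).Perm (J ++ t)) (ht' : (w.toList.map Prod.snd).Perm (J ++ t'))
    (hJ : invUnit u (J ++ t) = invUnit u (J ++ t')) (hg : ∀ a ∈ J, Commute g (x a)) :
    f.1 (((w.toList.map Prod.snd).map x).prod⁻¹ * g * ((w.toList.map Prod.fst).map x).prod) =
      wordWeight q w • f.1 ((t'.map x).prod⁻¹ * g * (t.map x).prod) := by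
  rw [wordWeight, ← coe_invUnit u hu, ← coe_invUnit u hu, ← Units.val_inv_eq_inv_val,
    ← Units.val_mul, ← equivariant_apply, prod_eq_of_perm u hx ht, prod_eq_of_perm u hx ht', hJ]
  refine congrArg f.1 ?_
  have hc : Commute g (J.map x).prod := by
    refine Commute.list_prod_right _ _ fun y hy => ?_
    obtain ⟨a, ha, rfl⟩ := List.mem_map.1 hy
    exact hg a ha
  simp only [List.map_append, List.prod_append]
  generalize invUnit u (J ++ t') = a
  generalize invUnit u (w.toList.map Prod.fst) = b
  generalize invUnit u (w.toList.map Prod.snd) = d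
  generalize (J.map x).prod = y at hc
  calc _ = (t'.map x).prod⁻¹ * y⁻¹ * ofScalar (d⁻¹ * a)⁻¹ * g *
        (ofScalar (b⁻¹ * a) * (y * (t.map x).prod)) := by
        rw [mul_inv_rev, ← map_inv, mul_inv_rev]
    _ = ofScalar (d⁻¹ * a)⁻¹ * ((t'.map x).prod⁻¹ * y⁻¹ * g * ofScalar (b⁻¹ * a)) *
        (y * (t.map x).prod) := by rw [mul_ofScalar]; simp only [mul_assoc]
    _ = ofScalar (d⁻¹ * a)⁻¹ * ofScalar (b⁻¹ * a) * ((t'.map x).prod⁻¹ * (y⁻¹ * (g * y)) *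
        (t.map x).prod) := by rw [mul_ofScalar]; simp only [mul_assoc]
    _ = _ := by
      rw [hc.eq, inv_mul_cancel_left, ← map_mul]
      congr 2
      simp [mul_comm]

end InvUnit

/-! ### Words in the twisted matrix -/

section Words

variable {κ : Type*}

theorem evalAt_of {S : Type*} [Ring S] [Algebra ℂ S] (A : Matrix κ κ S) (w : FreeMonoid (κ × κ)) :
    evalAt A (MonoidAlgebra.of ℂ _ w) = FreeMonoid.lift (fun x : κ × κ => A x.1 x.2) w :=
  MonoidAlgebra.lift_of _ _

theorem evalAt_varMatrix {S : Type*} [Ring S] [Algebra ℂ S] (A : Matrix κ κ S) (i k : κ) :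
    evalAt A (varMatrix κ i k) = A i k := by
  rw [varMatrix, Matrix.of_apply, evalAt_of, FreeMonoid.lift_eval_of]

variable {ι : Type*} [Fintype ι] {p : ι → ι → ℂˣ} {S : Type*} [Ring S] [Algebra ℂ S]

theorem ev_evalAt_of {x : κ → Heis p} {A : Matrix κ κ S} {T : Matrix κ κ (TwistRing p S)}
    {L : Set (Heis p)} (hL : ∀ g ∈ L, ∀ i k, (x k)⁻¹ * g * x i ∈ L)
    (hT : ∀ f, ∀ g ∈ L, ∀ i k, ev f g (T i k) = A i k * f.1 ((x k)⁻¹ * g * x i))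
    (f : equivariant p S) (w : FreeMonoid (κ × κ)) {g : Heis p} (hg : g ∈ L) :
    ev f g (evalAt T (MonoidAlgebra.of ℂ _ w)) = evalAt A (MonoidAlgebra.of ℂ _ w) *
      f.1 (((w.toList.map Prod.snd).map x).prod⁻¹ * g * ((w.toList.map Prod.fst).map x).prod) := by
  simp only [evalAt_of]
  induction w using FreeMonoid.inductionOn' generalizing g with
  | one => simp [ev_one]
  | of_mul a w ih =>
    rw [map_mul (FreeMonoid.lift _), map_mul (FreeMonoid.lift _), FreeMonoid.lift_eval_of,
      FreeMonoid.lift_eval_of, ev_mul, hT _ g hg,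
      act_apply, ih (hL g hg _ _), mul_assoc]
    simp [mul_assoc]

section Weight

variable [LinearOrder κ] (q : κ → κ → ℂ)

theorem applyWeight_add (f g : WordPoly κ) :
    applyWeight q (f + g) = applyWeight q f + applyWeight q g := by
  rw [applyWeight, MonoidAlgebra.coeff_add, Finsupp.sum_add_index']
  · rfl
  · simp
  · intro w b b'
    rw [mul_add, MonoidAlgebra.single_add]

theorem applyWeight_smul (c : ℂ) (f : WordPoly κ) :
    applyWeight q (c • f) = c • applyWeight q f := by
  rw [applyWeight, MonoidAlgebra.coeff_smul, Finsupp.sum_smul_index', applyWeight, Finsupp.smul_sum]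
  · refine Finsupp.sum_congr fun w _ => ?_
    rw [MonoidAlgebra.smul_single, smul_eq_mul, smul_eq_mul, mul_left_comm]
  · simp

theorem applyWeight_of (w : FreeMonoid (κ × κ)) :
    applyWeight q (MonoidAlgebra.of ℂ _ w) = wordWeight q w • MonoidAlgebra.of ℂ _ w := by
  rw [applyWeight, MonoidAlgebra.of_apply, MonoidAlgebra.smul_single]
  change Finsupp.sum (Finsupp.single w 1) _ = _
  rw [Finsupp.sum_single_index]
  · simp
  · simp

/-- If all words of `P` carry `g` to `g'` up to their weights, then the evaluation of `P` at the
operators is that of the weighted `P` at the underlying matrix. The operators need to be twists only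
at the points of `L`. -/
theorem ev_evalAt_eq_evalAt_applyWeight {x : κ → Heis p} {A : Matrix κ κ S}
    {T : Matrix κ κ (TwistRing p S)}
    {L : Set (Heis p)} (hL : ∀ g ∈ L, ∀ i k, (x k)⁻¹ * g * x i ∈ L)
    (hT : ∀ f, ∀ g ∈ L, ∀ i k, ev f g (T i k) = A i k * f.1 ((x k)⁻¹ * g * x i))
    (f : equivariant p S) {g g' : Heis p} (hg : g ∈ L) {W : Set (FreeMonoid (κ × κ))}
    (hW : ∀ w ∈ W, f.1 (((w.toList.map Prod.snd).map x).prod⁻¹ * g *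
      ((w.toList.map Prod.fst).map x).prod) = wordWeight q w • f.1 g') {P : WordPoly κ}
    (hP : P ∈ Submodule.span ℂ (MonoidAlgebra.of ℂ (FreeMonoid (κ × κ)) '' W)) :
    ev f g (evalAt T P) = evalAt A (applyWeight q P) * f.1 g' := by
  induction hP using Submodule.span_induction with
  | mem P h =>
    obtain ⟨w, hw, rfl⟩ := h
    rw [ev_evalAt_of hL hT f w hg, hW w hw, applyWeight_of, map_smul, mul_smul_comm,
      smul_mul_assoc]
  | zero =>
    have h0 : applyWeight q (0 : WordPoly κ) = 0 := by
      simpa using applyWeight_smul q 0 0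
    rw [h0]
    simp
  | add P Q _ _ hP hQ => rw [map_add, map_add, hP, hQ, applyWeight_add, map_add, add_mul]
  | smul c P _ hP => rw [map_smul, map_smul, hP, applyWeight_smul, map_smul, smul_mul_assoc]

end Weight

/-- The words whose row indices and column indices become the multisets `s` and `t` when the same
elements of `K` are added to both. -/
def balancedWords (K : Set κ) (s t : Multiset κ) : Set (FreeMonoid (κ × κ)) :=
  {w | ∃ D : Multiset κ, (∀ d ∈ D, d ∈ K) ∧ (w.toList.map Prod.fst : Multiset κ) + D = s ∧
    (w.toList.map Prod.snd : Multiset κ) + D = t}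

/-- An entry contributes either a letter with one row and one column index, or a constant, in which
case the two indices coincide and are recorded in the common multiset. -/
theorem prod_mem_span_balancedWords {m : Type*} {K : Set κ} {ρ γ : m → κ}
    {B : Matrix m m (WordPoly κ)} {c : Matrix m m ℂ}
    (hc : ∀ a b, c a b ≠ 0 → ρ a = γ b ∧ γ b ∈ K)
    (hB : ∀ a b, B a b = c a b • 1 - varMatrix κ (ρ a) (γ b)) (l : List (m × m)) :
    (l.map fun x => B x.1 x.2).prod ∈ Submodule.span ℂ (MonoidAlgebra.of ℂ (FreeMonoid (κ × κ)) ''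
      balancedWords K (l.map fun x => ρ x.1) (l.map fun x => γ x.2)) := by
  induction l with
  | nil =>
    refine Submodule.subset_span ⟨1, ⟨0, by simp, by simp, by simp⟩, map_one _⟩
  | cons x l ih =>
    obtain ⟨a, b⟩ := x
    have e : (((a, b) :: l).map fun x => B x.1 x.2).prod =
        B a b * (l.map fun x => B x.1 x.2).prod := List.prod_cons
    rw [e, hB, sub_mul, smul_mul_assoc, one_mul]
    refine Submodule.sub_mem _ ?_ ?_
    · by_cases h : c a b = 0
      · rw [h, zero_smul]
        exact Submodule.zero_mem _
      · obtain ⟨h1, h2⟩ := hc a b h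
        refine Submodule.smul_mem _ _ (Submodule.span_mono (Set.image_mono ?_) ih)
        rintro w ⟨D, hD, hs, ht⟩
        refine ⟨γ b ::ₘ D, ?_, ?_, ?_⟩
        · simpa using ⟨h2, hD⟩
        · rw [Multiset.add_cons, hs, ← h1]
          rfl
        · rw [Multiset.add_cons, ht]
          rfl
    · have hle : Submodule.span ℂ (MonoidAlgebra.of ℂ (FreeMonoid (κ × κ)) ''
          balancedWords K (l.map fun x => ρ x.1) (l.map fun x => γ x.2)) ≤
          (Submodule.span ℂ (MonoidAlgebra.of ℂ (FreeMonoid (κ × κ)) ''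
            balancedWords K (((a, b) :: l).map fun x => ρ x.1)
              (((a, b) :: l).map fun x => γ x.2))).comap
            (LinearMap.mulLeft ℂ (varMatrix κ (ρ a) (γ b))) := by
        rw [Submodule.span_le]
        rintro _ ⟨w, ⟨D, hD, hs, ht⟩, rfl⟩
        refine Submodule.subset_span ⟨FreeMonoid.of (ρ a, γ b) * w, ⟨D, hD, ?_, ?_⟩, ?_⟩
        · simp [← hs, ← Multiset.cons_coe]
        · simp [← ht, ← Multiset.cons_coe]
        · rw [map_mul]
          rfl
      exact hle ih

theorem colDet_mem_span_balancedWords {m : ℕ} {K : Set κ} {ρ γ : Fin m → κ}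
    {B : Matrix (Fin m) (Fin m) (WordPoly κ)} {c : Matrix (Fin m) (Fin m) ℂ}
    (hc : ∀ a b, c a b ≠ 0 → ρ a = γ b ∧ γ b ∈ K)
    (hB : ∀ a b, B a b = c a b • 1 - varMatrix κ (ρ a) (γ b)) :
    colDet B ∈ Submodule.span ℂ (MonoidAlgebra.of ℂ (FreeMonoid (κ × κ)) ''
      balancedWords K (List.ofFn ρ) (List.ofFn γ)) := by
  refine Submodule.sum_mem _ fun σ _ => ?_
  rw [← Int.cast_smul_eq_zsmul ℂ]
  refine Submodule.smul_mem _ _ ?_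
  have h := prod_mem_span_balancedWords hc hB (List.ofFn fun p => (σ p, p))
  simp only [List.map_ofFn, Function.comp_def] at h
  have e : ((List.ofFn fun p => ρ (σ p) : List κ) : Multiset κ) = List.ofFn ρ :=
    Multiset.coe_eq_coe.2 (by
      simpa [Function.comp_def] using Equiv.Perm.ofFn_comp_perm σ ρ)
  rwa [e] at h

end Words

/-! ### Invertibility of the corner determinant -/

section Invertible

theorem algHom_evalAt {κ S S' : Type*} [Ring S] [Algebra ℂ S] [Ring S'] [Algebra ℂ S']
    (φ : S →ₐ[ℂ] S') (A : Matrix κ κ S) (P : WordPoly κ) :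
    φ (evalAt A P) = evalAt (A.map φ) P := by
  induction P using MonoidAlgebra.induction_on with
  | of w =>
    rw [evalAt_of, evalAt_of]
    induction w using FreeMonoid.inductionOn' with
    | one => simp
    | of_mul a w ih =>
      rw [map_mul, map_mul, map_mul, ih]
      simp
  | add P Q hP hQ => rw [map_add, map_add, map_add, hP, hQ]
  | smul c P hP => rw [map_smul, map_smul, map_smul, hP]

theorem evalAt_colDet {κ S : Type*} [Ring S] [Algebra ℂ S] (A : Matrix κ κ S) {k : ℕ}
    (B : Matrix (Fin k) (Fin k) (WordPoly κ)) :
    evalAt A (colDet B) = colDet (B.map (evalAt A)) :=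
  map_colDet (evalAt A : WordPoly κ →+* S) B

theorem qDet_eq_applyWeight_colDet {κ : Type*} [LinearOrder κ] (q : κ → κ → ℂ) {k : ℕ}
    (B : Matrix (Fin k) (Fin k) (WordPoly κ)) : qDet q B = applyWeight q (colDet B) := rfl

/-- The empty word has weight `1`, so weighting does not change the constant coefficient. -/
theorem evalAt_zero_applyWeight {κ : Type*} [LinearOrder κ] (q : κ → κ → ℂ) (P : WordPoly κ) :
    evalAt (0 : Matrix κ κ ℂ) (applyWeight q P) = evalAt (0 : Matrix κ κ ℂ) P := by
  induction P using MonoidAlgebra.induction_on with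
  | of w =>
    rw [applyWeight_of, map_smul, evalAt_of]
    induction w using FreeMonoid.inductionOn' with
    | one => simp [wordWeight, invWeight]
    | of_mul a w ih =>
      rw [map_mul]
      simp
  | add P Q hP hQ => rw [applyWeight_add, map_add, map_add, hP, hQ]
  | smul c P hP => rw [applyWeight_smul, map_smul, map_smul, hP]

/-- The constant coefficient of a power series. -/
noncomputable def constCoeff (X : Type*) : NCPowerSeries X ℂ →ₐ[ℂ] ℂ where
  toFun f := f []
  map_one' := by simp [NCPowerSeries.one_apply]
  map_mul' f g := by simp [NCPowerSeries.mul_apply]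
  map_zero' := rfl
  map_add' _ _ := rfl
  commutes' c := by
    rw [Algebra.algebraMap_eq_smul_one, NCPowerSeries.smul_apply, NCPowerSeries.one_apply]
    simp

theorem isUnit_detCorner {n r : ℕ} (q : Fin (n + r) → Fin (n + r) → ℂ) {S : Type*} [Ring S]
    [Algebra ℂ S] (φ : NCPowerSeries (Fin (n + r) × Fin (n + r)) ℂ →ₐ[ℂ] S)
    {A : Matrix (Fin (n + r)) (Fin (n + r)) S}
    (hA : ∀ i k, A i k = φ (NCPowerSeries.var (i, k))) : IsUnit (detCorner n r q A) := by
  set X : Matrix (Fin (n + r)) (Fin (n + r)) (NCPowerSeries (Fin (n + r) × Fin (n + r)) ℂ) :=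
    Matrix.of fun i k => NCPowerSeries.var (i, k) with hX
  have hAX : A = X.map φ := by
    ext i k
    exact hA i k
  rw [detCorner, hAX, ← algHom_evalAt]
  refine IsUnit.map φ (NCPowerSeries.isUnit_of_apply_nil ?_)
  change constCoeff _ (evalAt X _) = 1
  have hX0 : X.map (constCoeff (Fin (n + r) × Fin (n + r))) = 0 := by
    ext i k
    change (NCPowerSeries.var (i, k) : NCPowerSeries _ ℂ) [] = 0
    simp [NCPowerSeries.var, NCPowerSeries.word]
  rw [algHom_evalAt, hX0, qDet_eq_applyWeight_colDet, evalAt_zero_applyWeight, evalAt_colDet]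
  have h1 : (1 - corner n r (varMatrix (Fin (n + r)))).map
      (evalAt (0 : Matrix (Fin (n + r)) (Fin (n + r)) ℂ)) = 1 := by
    ext i j
    rw [Matrix.map_apply, Matrix.sub_apply, map_sub, corner, Matrix.submatrix_apply,
      evalAt_varMatrix, Matrix.zero_apply, sub_zero, Matrix.one_apply, Matrix.one_apply]
    split_ifs <;> simp
  rw [h1, colDet_one]

end Invertible

/-! ### Determinants of the twisted matrix -/

section TwistedDeterminants

variable {ι : Type*} [Fintype ι] {p : ι → ι → ℂˣ} {S : Type*} [Ring S] [Algebra ℂ S]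

/-- At the identity of the group, the column determinant of `1 - T` acts as the `q`-determinant. The
matrix `T` needs to be a twist of `A` only at the points of `L`. -/
theorem ev_colDet_one_sub {k : ℕ} {q : Fin k → Fin k → ℂ} {u : Fin k → Fin k → ℂˣ}
    (hu : ∀ i j, i < j → (u i j : ℂ) = q i j) {x : Fin k → Heis p}
    (hx : ∀ i j, i < j → x j * x i = ofScalar (u i j)⁻¹ * (x i * x j))
    {A : Matrix (Fin k) (Fin k) S} {T : Matrix (Fin k) (Fin k) (TwistRing p S)}
    {L : Set (Heis p)} (hL : ∀ g ∈ L, ∀ i k, (x k)⁻¹ * g * x i ∈ L)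
    (hT : ∀ f, ∀ g ∈ L, ∀ i k, ev f g (T i k) = A i k * f.1 ((x k)⁻¹ * g * x i))
    (h1 : 1 ∈ L) (f : equivariant p S) :
    ev f 1 (colDet (1 - T)) = detOneSub q A * f.1 1 := by
  have hT' : 1 - T = (1 - varMatrix (Fin k)).map (evalAt T) := by
    ext i j
    rw [Matrix.map_apply, Matrix.sub_apply, Matrix.sub_apply, map_sub, evalAt_varMatrix,
      Matrix.one_apply, Matrix.one_apply]
    split_ifs <;> simp
  rw [hT', ← evalAt_colDet, detOneSub, qDet_eq_applyWeight_colDet]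
  refine ev_evalAt_eq_evalAt_applyWeight q hL hT f h1 ?_ (colDet_mem_span_balancedWords
    (K := Set.univ) (ρ := id) (γ := id) (c := 1) ?_ ?_)
  · rintro w ⟨D, -, hs, ht⟩
    have hp : (w.toList.map Prod.fst).Perm (w.toList.map Prod.snd) :=
      Multiset.coe_eq_coe.1 (add_right_cancel (hs.trans ht.symm))
    have := apply_conj_eq_wordWeight_smul u hu hx f 1 w (w.toList.map Prod.snd) [] []
      (by simpa using hp) (by simp) rfl (fun a _ => Commute.one_left _)
    simpa using this
  · intro a b hab
    refine ⟨?_, trivial⟩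
    by_contra h
    exact hab (Matrix.one_apply_ne h)
  · intro a b
    rw [Matrix.sub_apply, Matrix.one_apply, Matrix.one_apply]
    split_ifs <;> simp

variable {n r : ℕ} {p : Fin (n + r) → Fin (n + r) → ℂˣ}
  {q : Fin (n + r) → Fin (n + r) → ℂ} {u : Fin (n + r) → Fin (n + r) → ℂˣ}

theorem ev_colDet_one_sub_corner (hu : ∀ i j, i < j → (u i j : ℂ) = q i j)
    (hx : ∀ i j, i < j → (gen j * gen i : Heis p) = ofScalar (u i j)⁻¹ * (gen i * gen j))
    (A : Matrix (Fin (n + r)) (Fin (n + r)) S) (f : equivariant p S) {g : Heis p}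
    (hg : ∀ a : Fin n, Commute g (gen (Fin.castAdd r a))) :
    ev f g (colDet (1 - corner n r (twist p A))) = detCorner n r q A * f.1 g := by
  have hT' : 1 - corner n r (twist p A) =
      (1 - corner n r (varMatrix (Fin (n + r)))).map (evalAt (twist p A)) := by
    ext i j
    rw [Matrix.map_apply, Matrix.sub_apply, Matrix.sub_apply, map_sub, corner, corner,
      Matrix.submatrix_apply, Matrix.submatrix_apply, evalAt_varMatrix, Matrix.one_apply,
      Matrix.one_apply]
    split_ifs <;> simp
  rw [hT', ← evalAt_colDet, detCorner, qDet_eq_applyWeight_colDet]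
  refine ev_evalAt_eq_evalAt_applyWeight q (x := gen) (L := Set.univ) (fun _ _ _ _ => trivial)
    (fun f g _ i k => ev_twist A i k f g) f trivial ?_ (colDet_mem_span_balancedWords
      (K := Set.univ) (ρ := Fin.castAdd r) (γ := Fin.castAdd r) (c := 1) ?_ ?_)
  · rintro w ⟨D, -, hs, ht⟩
    have hp : (w.toList.map Prod.fst).Perm (w.toList.map Prod.snd) :=
      Multiset.coe_eq_coe.1 (add_right_cancel (hs.trans ht.symm))
    have := apply_conj_eq_wordWeight_smul u hu hx f g w (w.toList.map Prod.snd) [] []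
      (by simpa using hp) (by simp) rfl (fun a ha => ?_)
    · simpa using this
    · have ha' : a ∈ ((List.ofFn (Fin.castAdd r : Fin n → Fin (n + r)) : List _) :
          Multiset (Fin (n + r))) := by
        rw [← ht]
        exact Multiset.mem_add.2 (Or.inl (Multiset.mem_coe.2 ha))
      obtain ⟨b, rfl⟩ := List.mem_ofFn.1 (Multiset.mem_coe.1 ha')
      exact hg b
  · intro a b hab
    refine ⟨?_, trivial⟩
    by_contra h
    exact hab (Matrix.one_apply_ne fun h' => h (congrArg _ h'))
  · intro a b
    rw [Matrix.sub_apply, Matrix.one_apply, Matrix.one_apply]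
    split_ifs <;> simp [corner]

/-- The index map of the bordered matrix with border index `i`. -/
def borderIndex (n r : ℕ) (i : Fin r) : Fin (n + 1) → Fin (n + r) :=
  Fin.append (Fin.castAdd r) fun _ => Fin.natAdd n i

/-- The constant part of the bordered matrix; it vanishes at the last diagonal entry. -/
def borderConst (n : ℕ) (R : Type*) [Ring R] : Matrix (Fin (n + 1)) (Fin (n + 1)) R :=
  Matrix.reindex finSumFinEquiv finSumFinEquiv (Matrix.fromBlocks 1 0 0 0)

theorem bordered_apply {R : Type*} [Ring R] (A : Matrix (Fin (n + r)) (Fin (n + r)) R)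
    (i j : Fin r) (a b : Fin (n + 1)) :
    bordered n r A i j a b =
      borderConst n R a b - A (borderIndex n r i a) (borderIndex n r j b) := by
  induction a using Fin.addCases <;> induction b using Fin.addCases <;>
    simp [bordered, borderConst, borderIndex, corner]

theorem borderConst_castAdd {R : Type*} [Ring R] (a b : Fin n) :
    borderConst n R (Fin.castAdd 1 a) (Fin.castAdd 1 b) = (1 : Matrix (Fin n) (Fin n) R) a b := by
  simp [borderConst]

theorem borderConst_natAdd_left {R : Type*} [Ring R] (a : Fin 1) (b : Fin (n + 1)) :
    borderConst n R (Fin.natAdd n a) b = 0 := by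
  induction b using Fin.addCases <;> simp [borderConst]

theorem borderConst_natAdd_right {R : Type*} [Ring R] (a : Fin (n + 1)) (b : Fin 1) :
    borderConst n R a (Fin.natAdd n b) = 0 := by
  induction a using Fin.addCases <;> simp [borderConst]

theorem map_borderConst {R R' : Type*} [Ring R] [Ring R'] (φ : R →+* R') (a b : Fin (n + 1)) :
    φ (borderConst n R a b) = borderConst n R' a b := by
  induction a using Fin.addCases <;> induction b using Fin.addCases <;>
    simp [borderConst, Matrix.one_apply, apply_ite φ]

/-- In a word of the bordered determinant the two border indices do occur, since the constant part
of the bordered matrix is zero in the last row and column. -/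
theorem exists_perm_append_of_mem_balancedWords {i j : Fin r}
    {w : FreeMonoid (Fin (n + r) × Fin (n + r))}
    (hw : w ∈ balancedWords (Set.range (Fin.castAdd r)) (List.ofFn (borderIndex n r i))
      (List.ofFn (borderIndex n r j))) :
    ∃ J : List (Fin (n + r)), (∀ a ∈ J, a ∈ Set.range (Fin.castAdd r)) ∧
      (w.toList.map Prod.fst).Perm (J ++ [Fin.natAdd n i]) ∧
      (w.toList.map Prod.snd).Perm (J ++ [Fin.natAdd n j]) := by
  obtain ⟨D, hD, hs, ht⟩ := hw
  set I : List (Fin (n + r)) := List.ofFn (Fin.castAdd r : Fin n → Fin (n + r)) with hI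
  have hbd : ∀ i : Fin r, ((List.ofFn (borderIndex n r i) : List _) : Multiset (Fin (n + r))) =
      Fin.natAdd n i ::ₘ (I : Multiset (Fin (n + r))) := by
    intro i
    rw [ofFn_append_parts]
    simp only [borderIndex, Fin.append_left, Fin.append_right]
    rw [Multiset.cons_coe, Multiset.coe_eq_coe]
    have h1 : (List.ofFn fun _ : Fin 1 => Fin.natAdd n i) = [Fin.natAdd n i] := by simp
    rw [h1]
    exact List.perm_append_singleton (Fin.natAdd n i) I
  have key : ∀ (i : Fin r) (s : Multiset (Fin (n + r))),
      s + D = ((List.ofFn (borderIndex n r i) : List _) : Multiset (Fin (n + r))) →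
        ∃ J, s = Fin.natAdd n i ::ₘ J ∧ J + D = (I : Multiset (Fin (n + r))) := by
    intro i s h
    rw [hbd] at h
    have hmem : Fin.natAdd n i ∈ s + D := by rw [h]; exact Multiset.mem_cons_self _ _
    have hmem' : Fin.natAdd n i ∈ s := by
      refine (Multiset.mem_add.1 hmem).resolve_right fun hd => ?_
      obtain ⟨a, ha⟩ := hD _ hd
      have := congrArg Fin.val ha
      simp only [Fin.val_castAdd, Fin.val_natAdd] at this
      omega
    obtain ⟨J, rfl⟩ := Multiset.exists_cons_of_mem hmem'
    rw [Multiset.cons_add, Multiset.cons_inj_right] at h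
    exact ⟨J, rfl, h⟩
  obtain ⟨J, hJ, hJD⟩ := key i _ hs
  obtain ⟨J', hJ', hJD'⟩ := key j _ ht
  obtain rfl : J = J' := add_right_cancel (hJD.trans hJD'.symm)
  have hperm : ∀ (i : Fin r) (l : List (Fin (n + r))),
      (l : Multiset (Fin (n + r))) = Fin.natAdd n i ::ₘ J →
        l.Perm (J.toList ++ [Fin.natAdd n i]) := by
    intro i l h
    rw [← Multiset.coe_eq_coe, h, ← Multiset.coe_add, Multiset.coe_toList, Multiset.coe_singleton,
      add_comm J, Multiset.singleton_add]
  refine ⟨J.toList, fun a ha => ?_, hperm i _ hJ, hperm j _ hJ'⟩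
  have : a ∈ (I : Multiset (Fin (n + r))) := by
    rw [← hJD]
    exact Multiset.mem_add.2 (Or.inl (Multiset.mem_toList.1 ha))
  exact List.mem_ofFn.1 (Multiset.mem_coe.1 this)

theorem ev_colDet_bordered (hu : ∀ i j, i < j → (u i j : ℂ) = q i j)
    (hx : ∀ i j, i < j → (gen j * gen i : Heis p) = ofScalar (u i j)⁻¹ * (gen i * gen j))
    (A : Matrix (Fin (n + r)) (Fin (n + r)) S) (i j : Fin r) (f : equivariant p S) {g : Heis p}
    (hg : ∀ a : Fin n, Commute g (gen (Fin.castAdd r a))) :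
    ev f g (colDet (bordered n r (twist p A) i j)) = detBordered n r q A i j *
      f.1 ((gen (Fin.natAdd n j))⁻¹ * g * gen (Fin.natAdd n i)) := by
  have hT' : bordered n r (twist p A) i j =
      (bordered n r (varMatrix (Fin (n + r))) i j).map (evalAt (twist p A)) := by
    ext a b
    rw [Matrix.map_apply, bordered_apply, bordered_apply, map_sub, evalAt_varMatrix]
    congr 1
    exact (map_borderConst (evalAt (twist p A) : WordPoly (Fin (n + r)) →+* TwistRing p S) a b).symm
  rw [hT', ← evalAt_colDet, detBordered, qDet_eq_applyWeight_colDet]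
  refine ev_evalAt_eq_evalAt_applyWeight q (x := gen) (L := Set.univ) (fun _ _ _ _ => trivial)
    (fun f g _ i k => ev_twist A i k f g) f trivial ?_ (colDet_mem_span_balancedWords
      (K := Set.range (Fin.castAdd r)) (ρ := borderIndex n r i) (γ := borderIndex n r j)
      (c := borderConst n ℂ) ?_ ?_)
  · intro w hw
    obtain ⟨J, hJ, hs, ht⟩ := exists_perm_append_of_mem_balancedWords hw
    have hlt : ∀ i : Fin r, ∀ a ∈ J, a < Fin.natAdd n i := by
      intro i a ha
      obtain ⟨b, rfl⟩ := hJ a ha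
      rw [Fin.lt_def, Fin.val_castAdd, Fin.val_natAdd]
      omega
    have := apply_conj_eq_wordWeight_smul u hu hx f g w J _ _ hs ht
      (by rw [invUnit_append_singleton u J _ (hlt i), invUnit_append_singleton u J _ (hlt j)])
      (fun a ha => ?_)
    · simpa using this
    · obtain ⟨b, rfl⟩ := hJ a ha
      exact hg b
  · intro a b hab
    induction a using Fin.addCases with
    | right a => exact absurd (borderConst_natAdd_left a b) hab
    | left a =>
      induction b using Fin.addCases with
      | right b => exact absurd (borderConst_natAdd_right _ b) hab
      | left b =>
        rw [borderConst_castAdd] at hab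
        have : a = b := by
          by_contra h
          exact hab (Matrix.one_apply_ne h)
        subst this
        simp [borderIndex]
  · intro a b
    rw [bordered_apply]
    congr 1
    rw [← map_borderConst (algebraMap ℂ (WordPoly (Fin (n + r)))),
      Algebra.algebraMap_eq_smul_one]

end TwistedDeterminants

/-! ### The centralizer of the corner generators -/

section Centralizer

variable {n r : ℕ} {p : Fin (n + r) → Fin (n + r) → ℂˣ}

/-- The elements of the Heisenberg group that commute with the first `n` generators. -/
def cornerCentralizer (p : Fin (n + r) → Fin (n + r) → ℂˣ) : Set (Heis p) :=
  {g | ∀ a : Fin n, Commute g (gen (Fin.castAdd r a))}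

/-- If the commutation factor of a corner generator with the other generators does not depend on
the latter, then the quotients of these generators centralize the corner. -/
theorem conj_mem_cornerCentralizer {z : Fin n → ℂˣ}
    (hz : ∀ (a : Fin n) (i : Fin r), (gen (Fin.natAdd n i) * gen (Fin.castAdd r a) : Heis p) =
      ofScalar (z a) * (gen (Fin.castAdd r a) * gen (Fin.natAdd n i)))
    {g : Heis p} (hg : g ∈ cornerCentralizer p) (i k : Fin r) :
    (gen (Fin.natAdd n k))⁻¹ * g * gen (Fin.natAdd n i) ∈ cornerCentralizer p := by
  intro a
  have hk : (gen (Fin.natAdd n k))⁻¹ * gen (Fin.castAdd r a) =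
      ofScalar (z a)⁻¹ * (gen (Fin.castAdd r a) * (gen (Fin.natAdd n k) : Heis p)⁻¹) := by
    rw [inv_mul_eq_iff_eq_mul, ← mul_assoc, mul_ofScalar, mul_assoc, ← mul_assoc (gen _) (gen _),
      hz, mul_assoc, mul_assoc, mul_inv_cancel, mul_one, ← mul_assoc, ← map_mul, inv_mul_cancel,
      map_one, one_mul]
  change _ * _ = _ * _
  calc (gen (Fin.natAdd n k))⁻¹ * g * gen (Fin.natAdd n i) * gen (Fin.castAdd r a)
      = (gen (Fin.natAdd n k))⁻¹ * g * (gen (Fin.natAdd n i) * gen (Fin.castAdd r a)) := by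
        simp only [mul_assoc]
    _ = ofScalar (z a) * ((gen (Fin.natAdd n k))⁻¹ * (g * gen (Fin.castAdd r a)) *
          gen (Fin.natAdd n i)) := by
        rw [hz, ← mul_assoc, mul_ofScalar]
        simp only [mul_assoc]
    _ = ofScalar (z a) * (((gen (Fin.natAdd n k))⁻¹ * gen (Fin.castAdd r a)) * g *
          gen (Fin.natAdd n i)) := by
        rw [(hg a).eq]
        simp only [mul_assoc]
    _ = _ := by
        rw [hk]
        simp only [← mul_assoc]
        rw [← map_mul, mul_inv_cancel, map_one, one_mul]

end Centralizer

/-! ### The Sylvester identity -/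

section Sylvester

variable {n r : ℕ} {S : Type*} [Ring S] [Algebra ℂ S]

theorem isManin_bordered {T : Matrix (Fin (n + r)) (Fin (n + r)) S} (hT : IsManin T)
    (i j : Fin r) : IsManin (bordered n r T i j) := by
  have e : bordered n r T i j =
      borderConst n S - T.submatrix (borderIndex n r i) (borderIndex n r j) := by
    ext a b
    exact bordered_apply T i j a b
  rw [e]
  refine (hT.submatrix _ _).const_sub fun a b s => ?_
  rw [← map_borderConst (algebraMap ℂ S)]
  exact Algebra.commutes _ _

/-- The matrix `T₁₁ + T₁₀ * N * T₀₁` attached to the blocks of `T`. If `N` is the inverse of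
`1 - T₀₀`, then `1 - schurMatrix T N` is the Schur complement in `1 - T`. -/
def schurMatrix (T : Matrix (Fin (n + r)) (Fin (n + r)) S) (N : Matrix (Fin n) (Fin n) S) :
    Matrix (Fin r) (Fin r) S :=
  Matrix.of fun i j => T (Fin.natAdd n i) (Fin.natAdd n j) +
    ∑ k, T (Fin.natAdd n i) (Fin.castAdd r k) * ∑ l, N k l * T (Fin.castAdd r l) (Fin.natAdd n j)

variable {T : Matrix (Fin (n + r)) (Fin (n + r)) S} {N : Matrix (Fin n) (Fin n) S}

/-- The classical Sylvester identity for Manin matrices. -/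
theorem colDet_one_sub_eq (hT : IsManin T) (hN : (1 - corner n r T) * N = 1) :
    colDet (1 - T) = colDet (1 - corner n r T) * colDet (1 - schurMatrix T N) := by
  have hne : ∀ (a : Fin n) (b : Fin r), Fin.castAdd r a ≠ Fin.natAdd n b := by
    intro a b h
    have := congrArg Fin.val h
    simp only [Fin.val_castAdd, Fin.val_natAdd] at this
    omega
  have hc : corner n r (1 - T) = 1 - corner n r T := by
    ext i j
    simp [corner, Matrix.one_apply]
  rw [← hc] at hN ⊢
  refine hT.one_sub.colDet_eq_mul_schur hN fun i j => ?_
  simp only [Matrix.sub_apply, schurMatrix, Matrix.of_apply,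
    Matrix.one_apply_ne (hne _ _), Matrix.one_apply_ne (hne _ _).symm, zero_sub, mul_neg, neg_mul,
    Finset.sum_neg_distrib, neg_neg, Matrix.one_apply, (Fin.natAdd_injective r n).eq_iff]
  abel

theorem colDet_bordered_eq (hT : IsManin T) (hN : (1 - corner n r T) * N = 1) (i j : Fin r) :
    colDet (bordered n r T i j) = colDet (1 - corner n r T) * -schurMatrix T N i j := by
  have hc : corner n 1 (bordered n r T i j) = 1 - corner n r T := by
    ext a b
    rw [corner, Matrix.submatrix_apply, bordered_apply, borderConst_castAdd]
    simp [borderIndex, corner]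
  rw [← hc] at hN ⊢
  rw [(isManin_bordered hT i j).colDet_eq_mul_schur hN
    (C := Matrix.of fun _ _ => -schurMatrix T N i j), colDet_fin_one, Matrix.of_apply]
  intro a b
  simp only [bordered_apply, borderConst_natAdd_left, borderConst_natAdd_right]
  simp [borderIndex, schurMatrix]
  abel

end Sylvester

/-- The parameter `q i j` as a unit, with value `1` where it vanishes. -/
noncomputable def unitParam {ι : Type*} (q : ι → ι → ℂ) (i j : ι) : ℂˣ :=
  if h : q i j ≠ 0 then Units.mk0 (q i j) h else 1

theorem coe_unitParam {ι : Type*} {q : ι → ι → ℂ} {i j : ι} (h : q i j ≠ 0) :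
    (unitParam q i j : ℂ) = q i j := by
  rw [unitParam, dif_pos h, Units.val_mk0]

/-- The Sylvester identity over any algebra in which the matrix is the image of the matrix of
variables. -/
theorem sylvester_of_algHom {n r : ℕ} {q : Fin (n + r) → Fin (n + r) → ℂ}
    (hq : ∀ i j, i < j → q i j ≠ 0)
    (hconst : ∀ (i i' : Fin n) (j j' : Fin r),
      q (Fin.castAdd r i) (Fin.natAdd n j) = q (Fin.castAdd r i') (Fin.natAdd n j'))
    {S : Type*} [Ring S] [Algebra ℂ S]
    (φ : NCPowerSeries (Fin (n + r) × Fin (n + r)) ℂ →ₐ[ℂ] S)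
    {A : Matrix (Fin (n + r)) (Fin (n + r)) S}
    (hφ : ∀ i k, A i k = φ (NCPowerSeries.var (i, k))) (hA : IsRightQuantum q A) :
    Ring.inverse (detCorner n r q A) * detOneSub q A =
      detOneSub (fun k l : Fin r => q (Fin.natAdd n k) (Fin.natAdd n l))
        (sylvesterMatrix n r q A) := by
  set u := unitParam q with hu_def
  set p : Fin (n + r) → Fin (n + r) → ℂˣ := fun i j => if i < j then u i j else 1 with hp_def
  have hu : ∀ i j, i < j → (u i j : ℂ) = q i j := fun i j h => coe_unitParam (hq i j h)
  have hp : ∀ i j, i < j → p i j = u i j := fun i j h => if_pos h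
  have hp' : ∀ i j, i < j → p j i = 1 := fun i j h => if_neg h.not_gt
  have hx : ∀ i j, i < j → (gen j * gen i : Heis p) = ofScalar (u i j)⁻¹ * (gen i * gen j) := by
    intro i j h
    rw [gen_mul_gen, hp i j h, hp' i j h, one_mul]
  have hlt : ∀ (a : Fin n) (b : Fin r), Fin.castAdd r a < Fin.natAdd n b := by
    intro a b
    rw [Fin.lt_def, Fin.val_castAdd, Fin.val_natAdd]
    omega
  set D := detCorner n r q A with hD
  have hDu : IsUnit D := isUnit_detCorner q φ hφ
  set T := twist p A with hT
  have hM : IsManin T :=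
    isManin_twist (fun i j h => by rw [hp i j h, hu i j h]) hp' hA
  set N := pathMatrix (Fin.castAdd r : Fin n → Fin (n + r)) φ p with hN_def
  have hN : (1 - corner n r T) * N = 1 := one_sub_twist_mul_pathMatrix _ φ hφ
  -- The parameters between the corner and its complement being equal, the points reached by the
  -- entries of the Schur complement stay in the centralizer of the corner.
  have hcent : ∀ g ∈ cornerCentralizer p, ∀ i k : Fin r,
      (gen (Fin.natAdd n k))⁻¹ * g * gen (Fin.natAdd n i) ∈ cornerCentralizer p := by
    intro g hg i k
    refine conj_mem_cornerCentralizer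
      (z := fun a => (u (Fin.castAdd r a) (Fin.natAdd n i))⁻¹) (fun a j => ?_) hg i k
    have e : u (Fin.castAdd r a) (Fin.natAdd n i) = u (Fin.castAdd r a) (Fin.natAdd n j) := by
      apply Units.ext
      rw [hu _ _ (hlt a i), hu _ _ (hlt a j), hconst a a i j]
    rw [e]
    exact hx _ _ (hlt a j)
  have hC : ∀ (f : equivariant p S), ∀ g ∈ cornerCentralizer p, ∀ i k : Fin r,
      ev f g (schurMatrix T N i k) = sylvesterMatrix n r q A i k *
        f.1 ((gen (Fin.natAdd n k))⁻¹ * g * gen (Fin.natAdd n i)) := by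
    intro f g hg i k
    have h1 := ev_colDet_bordered hu hx A i k f hg
    rw [colDet_bordered_eq hM hN, ev_mul, ev_colDet_one_sub_corner hu hx A _ hg, act_apply,
      map_neg, ← hD] at h1
    rw [sylvesterMatrix, Matrix.of_apply, ← hD, neg_mul, mul_assoc, ← h1, ← mul_assoc,
      Ring.inverse_mul_cancel D hDu, one_mul, neg_neg]
  have h1 : (1 : Heis p) ∈ cornerCentralizer p := fun a => Commute.one_left _
  have hleft : ev (baseFn : equivariant p S) 1 (colDet (1 - T)) = detOneSub q A := by
    rw [ev_colDet_one_sub hu hx (L := Set.univ) (fun _ _ _ _ => trivial)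
      (fun f g _ i k => ev_twist A i k f g) trivial, baseFn_one, mul_one]
  have hright : ev (baseFn : equivariant p S) 1 (colDet (1 - schurMatrix T N)) =
      detOneSub (fun k l : Fin r => q (Fin.natAdd n k) (Fin.natAdd n l))
        (sylvesterMatrix n r q A) := by
    rw [ev_colDet_one_sub (u := fun k l => u (Fin.natAdd n k) (Fin.natAdd n l))
      (x := fun k => gen (Fin.natAdd n k)) (fun i j h => hu _ _ (by simpa using h))
      (fun i j h => hx _ _ (by simpa using h)) hcent hC h1, baseFn_one, mul_one]
  rw [← hleft, ← hright, colDet_one_sub_eq hM hN, ev_mul, ev_colDet_one_sub_corner hu hx A _ h1,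
    act_apply, ← mul_assoc, ← hD, Ring.inverse_mul_cancel D hDu, one_mul]

end QSylvester

theorem theorem1p2 (n r : ℕ) (hr : 0 < r) (q : Fin (n + r) → Fin (n + r) → ℂ)
    (hq : ∀ i j, i < j → q i j ≠ 0)
    (hconst : ∀ (i i' : Fin n) (j j' : Fin r),
      q (Fin.castAdd r i) (Fin.natAdd n j) = q (Fin.castAdd r i') (Fin.natAdd n j'))
    (I : TwoSidedIdeal (NCPowerSeries (Fin (n + r) × Fin (n + r)) ℂ))
    (hA : QSylvester.IsRightQuantum q (QSylvester.quotientMatrix I)) :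
    IsUnit (QSylvester.detCorner n r q (QSylvester.quotientMatrix I)) ∧
      Ring.inverse (QSylvester.detCorner n r q (QSylvester.quotientMatrix I)) *
          QSylvester.detOneSub q (QSylvester.quotientMatrix I) =
        QSylvester.detOneSub (fun k l : Fin r => q (Fin.natAdd n k) (Fin.natAdd n l))
          (QSylvester.sylvesterMatrix n r q (QSylvester.quotientMatrix I)) := by
  let φ : NCPowerSeries (Fin (n + r) × Fin (n + r)) ℂ →ₐ[ℂ] I.ringCon.Quotient :=
    { I.ringCon.mk' with commutes' := fun _ => rfl }
  exact ⟨QSylvester.isUnit_detCorner q φ fun _ _ => rfl,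
    QSylvester.sylvester_of_algHom hq hconst φ (fun _ _ => rfl) hA⟩
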